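/- Let $\alpha>-\tfrac12$, let $N\ge 1$ and $n\ge 0$ be integers, and put $$n(\alpha,N):=\tfrac12-\alpha+\tfrac12\sqrt{(2\alpha+1)(2\alpha+2N+1)},$$ $$D_{n,N}:=\frac{2^{n+1}\,\Gamma(n+2\alpha+2)\,\Gamma(n+\alpha+2)}{(n+1)!\,\Gamma(2n+2\alpha+3)\,\Gamma(\alpha+1)}\cdot\frac{N!}{N^{n+1}(N-n-1)!}.$$ For $0\le k\le N$ let $$Q_k(x)=Q_k(x;\alpha,\alpha,N)=\sum_{j=0}^{k}\frac{(-k)_j\,(k+2\alpha+1)_j\,(-x)_j}{(\alpha+1)_j\,(-N)_j}\,\frac1{j!}$$ be the symmetric Hahn polynomials, where $(a)_j=a(a+1)\cdots(a+j-1)$, and let $$\langle g,h\rangle_\omega=\sum_{i=0}^{N}g(i)h(i)\,\omega(i),\qquad \omega(i)=\binom{\alpha+i}{i}\binom{\alpha+N-i}{N-i}.$$ For $f:[-1,1]\to\mathbb R$ let $$LS_n^N[f](x)=\sum_{k=0}^{n}\frac{\langle f(\tfrac2N(\cdot)-1),\,Q_k\rangle_\omega}{\langle Q_k,Q_k\rangle_\omega}\,Q_k\!\left(\tfrac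 N2(1+x)\right)$$ be the discrete least-squares approximation of degree $n$ on the $N+1$ equidistant nodes $-1+2i/N$, $i=0,\dots,N$, written as a Hahn expansion. Suppose that $n+1\le n(\alpha,N)$ (which implies $n+1\le N$). Then for every $f\in C^{n+1}[-1,1]$ $$\sup_{x\in[-1,1]}\bigl|f(x)-LS_n^N[f](x)\bigr|\;\le\; D_{n,N}\,\sup_{x\in[-1,1]}\bigl|f^{(n+1)}(x)\bigr| .$$ The constant is sharp: for all such $\alpha,N,n$, if $C$ is a real number such that this inequality with $C$ in place of $D_{n,N}$ holds for every $f\in C^{n+1}[-1,1]$, then $C\ge D_{n,N}$. -/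

import Mathlib

noncomputable section

/-- The rising factorial (Pochhammer symbol) `(a)_k = a (a+1) ⋯ (a+k-1)`. -/
def poch (a : ℝ) (k : ℕ) : ℝ := (ascPochhammer ℝ k).eval a

/-- The Hahn polynomial `Q_n(x; α, β, N) = ₃F₂(-n, n+α+β+1, -x; α+1, -N; 1)`,
for `α, β > -1` and `n ≤ N`. -/
def hahnQ (α β : ℝ) (N n : ℕ) (x : ℝ) : ℝ :=
  ∑ k ∈ Finset.range (n + 1),
    (poch (-(n : ℝ)) k * poch ((n : ℝ) + α + β + 1) k * poch (-x) k) /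
      (poch (α + 1) k * poch (-(N : ℝ)) k) * (1 / (Nat.factorial k : ℝ))

/-- The Hahn weight `ω(i) = binom(α+i, i) binom(β+N-i, N-i)` at the grid points `i = 0, …, N`
(generalized binomial coefficients with real upper argument). -/
def hahnWeight (α β : ℝ) (N i : ℕ) : ℝ :=
  Ring.choose (α + (i : ℝ)) i * Ring.choose (β + (N : ℝ) - (i : ℝ)) (N - i)

/-- The discrete inner product `⟨f, g⟩_ω = ∑_{i=0}^N f(i) g(i) ω(i)`. -/
def hahnInner (α β : ℝ) (N : ℕ) (f g : ℝ → ℝ) : ℝ :=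
  ∑ i ∈ Finset.range (N + 1), f (i : ℝ) * g (i : ℝ) * hahnWeight α β N i

/-- The discrete least-squares approximation of degree `n` of a function `f` on `[-1, 1]`, in the
symmetric case `β = α`, as the Hahn expansion
`∑_{k=0}^n (⟨f(2(·)/N - 1), Q_k⟩_ω / ⟨Q_k, Q_k⟩_ω) Q_k(N(1+x)/2)`. -/
def leastSquares (α : ℝ) (N n : ℕ) (f : ℝ → ℝ) (x : ℝ) : ℝ :=
  ∑ k ∈ Finset.range (n + 1),
    hahnInner α α N (fun t => f (2 / (N : ℝ) * t - 1)) (hahnQ α α N k) /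
        hahnInner α α N (hahnQ α α N k) (hahnQ α α N k) *
      hahnQ α α N k ((N : ℝ) / 2 * (1 + x))

/-- `sup_{x ∈ [-1,1]} |g x|`; only used for functions that are continuous on `[-1, 1]`, so that
the set is bounded. -/
def supNorm (g : ℝ → ℝ) : ℝ :=
  sSup ((fun x => |g x|) '' Set.Icc (-1 : ℝ) 1)

/-- `n(α, N) = 1/2 - α + (1/2) √((2α+1)(2α+2N+1))`. -/
def degreeBound (α : ℝ) (N : ℕ) : ℝ :=
  1 / 2 - α + 1 / 2 * Real.sqrt ((2 * α + 1) * (2 * α + 2 * (N : ℝ) + 1))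

/-- The constant `D_{n,N}`. The truncated difference `N - n - 1` is the true one, as
`1 ≤ N` and `n + 1 ≤ n(α, N)` imply `n + 1 ≤ N`. -/
def constD (α : ℝ) (n N : ℕ) : ℝ :=
  (2 ^ (n + 1) * Real.Gamma ((n : ℝ) + 2 * α + 2) * Real.Gamma ((n : ℝ) + α + 2)) /
      ((Nat.factorial (n + 1) : ℝ) * Real.Gamma (2 * (n : ℝ) + 2 * α + 3) *
        Real.Gamma (α + 1)) *
    ((Nat.factorial N : ℝ) / ((N : ℝ) ^ (n + 1) * (Nat.factorial (N - n - 1) : ℝ)))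

end

open Polynomial Set

/-! Moved to [-1,1] and normalized by q_k(1) = 1, the symmetric Hahn polynomials satisfy t q_k = a_k
q_{k+1} + (1 - a_k) q_{k-1} with a_0 = 1. The constant D_{n,N} equals a_0⋯a_n/(n+1)!, and the degree
condition is equivalent to a_n ≥ 1/2. It forces a_j ≥ 1/2 for all j ≤ n, hence |q_k| ≤ 1 on [-1,1]
for k ≤ n+1 (`abs_walkPoly_eval_le_one`).

Upper bound (`abs_sub_sum_walkPoly_le`): the reproducing kernel and Christoffel-Darboux express the
error at x through the divided differences f[x,t_i] summed against q_{n+1}(x) q_n - q_n(x) q_{n+1}.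
This is a combination of q_n - q_{n+1} and q_n + q_{n+1}, with coefficients q_n(x) ± q_{n+1}(x)
whose absolute values add up to at most 2. The polynomial q_n ∓ q_{n+1} vanishes at ±1, and its
quotient V by that linear factor is orthogonal to lower degrees for the nonnegative weight ω(1 ∓ t).
So V has n zeros in (-1,1). Interpolating f at x and these zeros changes nothing in the sum up to a
remainder, which is at most M/(n+1)! |W| with W the node polynomial of the zeros. As VW has constant
sign, the sum of |VW| is computed exactly by orthogonality (`exists_finset_abs_sum_slope_le`).

Sharpness: q_{n+1} has zero approximation, value 1 at 1 and constant derivative (n+1)!/(a_0⋯a_n). -/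

/-! ### Rolle's theorem and the interpolation error -/

theorem exists_strictMono_zeros_derivWithin {g : ℝ → ℝ} {m : ℕ}
    (hg : ContDiffOn ℝ 1 g (Icc (-1) 1)) (z : ℕ → ℝ)
    (hz : ∀ i < m + 1, z i < z (i + 1)) (hmem : ∀ i ≤ m + 1, z i ∈ Icc (-1 : ℝ) 1)
    (h0 : ∀ i ≤ m + 1, g (z i) = 0) :
    ∃ y : ℕ → ℝ, (∀ i < m, y i < y (i + 1)) ∧ (∀ i ≤ m, y i ∈ Icc (-1 : ℝ) 1) ∧
      ∀ i ≤ m, derivWithin g (Icc (-1) 1) (y i) = 0 := by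
  have key : ∀ i, ∃ y, i ≤ m → (y ∈ Ioo (z i) (z (i + 1)) ∧
      derivWithin g (Icc (-1) 1) y = 0) := by
    intro i
    by_cases hi : i ≤ m
    · have hsub : Icc (z i) (z (i + 1)) ⊆ Icc (-1 : ℝ) 1 :=
        Icc_subset_Icc (hmem i (by omega)).1 (hmem (i + 1) (by omega)).2
      obtain ⟨c, hc, hc0⟩ := exists_hasDerivAt_eq_zero (f := g)
        (f' := derivWithin g (Icc (-1) 1)) (hz i (by omega)) (hg.continuousOn.mono hsub)
        (by rw [h0 i (by omega), h0 (i + 1) (by omega)]) (by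
          intro x hx
          have hx' : Icc (-1 : ℝ) 1 ∈ nhds x :=
            Icc_mem_nhds ((hmem i (by omega)).1.trans_lt hx.1)
              (hx.2.trans_le (hmem (i + 1) (by omega)).2)
          have hd := (hg.differentiableOn (by norm_num)) x (mem_of_mem_nhds hx')
          exact hd.hasDerivWithinAt.hasDerivAt hx')
      exact ⟨c, fun _ => ⟨hc, hc0⟩⟩
    · exact ⟨0, fun h => absurd h hi⟩
  choose y hy using key
  refine ⟨y, fun i hi => ?_, fun i hi => ?_, fun i hi => (hy i hi).2⟩
  · exact ((hy i hi.le).1.2).trans (hy (i + 1) hi).1.1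
  · exact ⟨(hmem i (by omega)).1.trans (hy i hi).1.1.le,
      (hy i hi).1.2.le.trans (hmem (i + 1) (by omega)).2⟩

/-- Generalized Rolle theorem on `[-1, 1]`. -/
theorem exists_iteratedDerivWithin_eq_zero_of_seq {m : ℕ} : ∀ {g : ℝ → ℝ}
    (_ : ContDiffOn ℝ (m : WithTop ℕ∞) g (Icc (-1) 1)) (z : ℕ → ℝ)
    (_ : ∀ i < m, z i < z (i + 1)) (_ : ∀ i ≤ m, z i ∈ Icc (-1 : ℝ) 1)
    (_ : ∀ i ≤ m, g (z i) = 0),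
    ∃ ξ ∈ Icc (-1 : ℝ) 1, iteratedDerivWithin m g (Icc (-1) 1) ξ = 0 := by
  induction m with
  | zero =>
    intro g _ z _ hmem h0
    exact ⟨z 0, hmem 0 le_rfl, by simpa using h0 0 le_rfl⟩
  | succ m ih =>
    intro g hg z hz hmem h0
    obtain ⟨y, hy, hymem, hy0⟩ := exists_strictMono_zeros_derivWithin
      (hg.of_le (by exact_mod_cast Nat.le_add_left 1 m)) z hz hmem h0
    have hd : ContDiffOn ℝ (m : WithTop ℕ∞) (derivWithin g (Icc (-1) 1)) (Icc (-1) 1) :=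
      hg.derivWithin (uniqueDiffOn_Icc (by norm_num)) (by norm_cast)
    obtain ⟨ξ, hξ, h⟩ := ih hd y hy hymem hy0
    exact ⟨ξ, hξ, by rw [iteratedDerivWithin_succ']; exact h⟩

theorem exists_iteratedDerivWithin_eq_zero_of_finset {m : ℕ} {g : ℝ → ℝ}
    (hg : ContDiffOn ℝ (m : WithTop ℕ∞) g (Icc (-1) 1)) (s : Finset ℝ) (hs : s.card = m + 1)
    (hmem : ∀ z ∈ s, z ∈ Icc (-1 : ℝ) 1) (h0 : ∀ z ∈ s, g z = 0) :
    ∃ ξ ∈ Icc (-1 : ℝ) 1, iteratedDerivWithin m g (Icc (-1) 1) ξ = 0 := by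
  let e := s.orderEmbOfFin hs
  let z : ℕ → ℝ := fun i => if h : i < m + 1 then e ⟨i, h⟩ else 0
  have hz : ∀ i (h : i < m + 1), z i = e ⟨i, h⟩ := fun i h => dif_pos h
  have hin : ∀ i ≤ m, z i ∈ s := fun i hi => by
    rw [hz i (by omega)]; exact s.orderEmbOfFin_mem hs _
  refine exists_iteratedDerivWithin_eq_zero_of_seq hg z (fun i hi => ?_)
    (fun i hi => hmem _ (hin i hi)) (fun i hi => h0 _ (hin i hi))
  rw [hz i (by omega), hz (i + 1) (by omega)]
  exact e.strictMono (by simp [Fin.lt_def])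

theorem polynomial_contDiff (P : ℝ[X]) {m : WithTop ℕ∞} : ContDiff ℝ m fun t => P.eval t := by
  simpa using P.contDiff_aeval (𝕜 := ℝ) m

theorem iteratedDerivWithin_polynomial_eval (P : ℝ[X]) {m : ℕ} (hP : P.natDegree ≤ m) {x : ℝ}
    (hx : x ∈ Icc (-1 : ℝ) 1) :
    iteratedDerivWithin m (fun t => P.eval t) (Icc (-1) 1) x = m.factorial * P.coeff m := by
  have hd : Polynomial.derivative^[m] P = C ((m.factorial : ℝ) * P.coeff m) := by
    ext k
    rw [coeff_iterate_derivative, coeff_C]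
    rcases Nat.eq_zero_or_pos k with rfl | hk
    · simp [Nat.descFactorial_self]
    · rw [coeff_eq_zero_of_natDegree_lt (by omega), if_neg (by omega)]; simp
  rw [iteratedDerivWithin_eq_iteratedDeriv (uniqueDiffOn_Icc (by norm_num))
    (polynomial_contDiff P).contDiffAt hx, iteratedDeriv_eq_iterate]
  have : ∀ (k : ℕ) (Q : ℝ[X]), deriv^[k] (fun t => Q.eval t) = fun t => (derivative^[k] Q).eval t := by
    intro k
    induction k with
    | zero => intro Q; rfl
    | succ k ih =>
      intro Q
      rw [Function.iterate_succ_apply, Function.iterate_succ_apply, ← ih]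
      congr 1
      ext t; exact Q.deriv
  rw [this, hd]; simp

/-- Lagrange error bound for a function vanishing at the `n + 1` nodes in `s`, up to a polynomial
`I` of degree at most `n`. -/
theorem abs_sub_eval_le_prod {n : ℕ} {f : ℝ → ℝ}
    (hf : ContDiffOn ℝ ((n + 1 : ℕ) : WithTop ℕ∞) f (Icc (-1) 1)) {M : ℝ}
    (hM : ∀ ξ ∈ Icc (-1 : ℝ) 1, |iteratedDerivWithin (n + 1) f (Icc (-1) 1) ξ| ≤ M)
    (s : Finset ℝ) (hs : s.card = n + 1) (hmem : ∀ z ∈ s, z ∈ Icc (-1 : ℝ) 1)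
    {I : ℝ[X]} (hI : I.natDegree ≤ n) (h0 : ∀ z ∈ s, I.eval z = f z) {y : ℝ}
    (hy : y ∈ Icc (-1 : ℝ) 1) :
    |f y - I.eval y| ≤ M / (n + 1).factorial * |∏ z ∈ s, (y - z)| := by
  by_cases hys : y ∈ s
  · rw [h0 y hys, sub_self, abs_zero, Finset.prod_eq_zero hys (sub_self y)]; simp
  have hprod : ∏ z ∈ s, (y - z) ≠ 0 :=
    Finset.prod_ne_zero_iff.mpr fun z hz h => hys (by rwa [sub_eq_zero.mp h])
  -- Chosen so that f - P vanishes at y as well as on s; Rolle with n + 2 zeros then identifies κ as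
  -- f^(n+1)(ξ)/(n+1)!.
  set κ : ℝ := (f y - I.eval y) / ∏ z ∈ s, (y - z) with hκ
  set P : ℝ[X] := I + C κ * ∏ z ∈ s, (X - C z) with hPdef
  have hmonic : (∏ z ∈ s, (X - C z) : ℝ[X]).Monic := monic_prod_X_sub_C (fun z => z) s
  have hdeg : (∏ z ∈ s, (X - C z) : ℝ[X]).natDegree = n + 1 := by
    rw [natDegree_prod_of_monic _ _ fun z _ => monic_X_sub_C z]; simp [hs]
  have hPn : P.natDegree ≤ n + 1 := by
    refine natDegree_add_le_of_degree_le (hI.trans (Nat.le_succ n)) ?_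
    exact (natDegree_C_mul_le _ _).trans hdeg.le
  have hPc : P.coeff (n + 1) = κ := by
    have h1 : (∏ z ∈ s, (X - C z) : ℝ[X]).coeff (n + 1) = 1 := by
      rw [← hdeg]; exact hmonic
    rw [hPdef, coeff_add, coeff_C_mul, h1, coeff_eq_zero_of_natDegree_lt (by omega)]; ring
  have hPev : ∀ t, P.eval t = I.eval t + κ * ∏ z ∈ s, (t - z) := by
    intro t; simp [hPdef, eval_prod]
  have hPd : ContDiffOn ℝ ((n + 1 : ℕ) : WithTop ℕ∞) (fun t => P.eval t) (Icc (-1) 1) :=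
    (polynomial_contDiff P).contDiffOn
  obtain ⟨ξ, hξ, h⟩ := exists_iteratedDerivWithin_eq_zero_of_finset (hf.sub hPd) (insert y s)
    (by rw [Finset.card_insert_of_notMem hys, hs])
    (by intro z hz
        rcases Finset.mem_insert.mp hz with rfl | hz
        · exact hy
        · exact hmem z hz)
    (by intro z hz
        rcases Finset.mem_insert.mp hz with rfl | hz
        · rw [hPev, hκ, div_mul_cancel₀ _ hprod]; ring
        · rw [hPev, Finset.prod_eq_zero hz (sub_self z), h0 z hz]; ring)
  have hsub : iteratedDerivWithin (n + 1) (fun t => f t - P.eval t) (Icc (-1) 1) ξ =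
      iteratedDerivWithin (n + 1) f (Icc (-1) 1) ξ - (n + 1).factorial * κ := by
    rw [← hPc, ← iteratedDerivWithin_polynomial_eval P hPn hξ]
    exact iteratedDerivWithin_sub hξ (uniqueDiffOn_Icc (by norm_num)) (hf ξ hξ) (hPd ξ hξ)
  rw [hsub, sub_eq_zero] at h
  have hfac : (0 : ℝ) < (n + 1).factorial := by exact_mod_cast Nat.factorial_pos _
  have hκM : |κ| ≤ M / (n + 1).factorial := by
    rw [le_div_iff₀ hfac, mul_comm, ← abs_of_pos hfac, ← abs_mul, ← h]
    exact hM ξ hξ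
  have : f y - I.eval y = κ * ∏ z ∈ s, (y - z) := by rw [hκ, div_mul_cancel₀ _ hprod]
  rw [this, abs_mul]
  exact mul_le_mul_of_nonneg_right hκM (abs_nonneg _)

/-! ### Sign changes and divided differences -/

/-- Every nonzero real polynomial becomes of constant sign on `[-1, 1]` after multiplication by
linear factors at some of its roots in `(-1, 1)`. -/
theorem exists_finset_roots_mul_prod_sign (m : ℕ) : ∀ P : ℝ[X], P ≠ 0 → P.natDegree ≤ m →
    ∃ Z : Finset ℝ, (∀ z ∈ Z, z ∈ Ioo (-1 : ℝ) 1 ∧ P.IsRoot z) ∧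
      ((∀ t ∈ Icc (-1 : ℝ) 1, 0 ≤ P.eval t * ∏ z ∈ Z, (t - z)) ∨
        (∀ t ∈ Icc (-1 : ℝ) 1, P.eval t * ∏ z ∈ Z, (t - z) ≤ 0)) := by
  have noroot : ∀ P : ℝ[X], (∀ z ∈ Ioo (-1 : ℝ) 1, ¬ P.IsRoot z) →
      ((∀ t ∈ Icc (-1 : ℝ) 1, 0 ≤ P.eval t) ∨ (∀ t ∈ Icc (-1 : ℝ) 1, P.eval t ≤ 0)) := by
    intro P hP
    have hcl : closure (Ioo (-1 : ℝ) 1) = Icc (-1) 1 := closure_Ioo (by norm_num)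
    by_cases hpos : ∀ t ∈ Ioo (-1 : ℝ) 1, 0 ≤ P.eval t
    · left
      rw [← hcl]
      exact fun t ht => closure_minimal (s := Ioo (-1 : ℝ) 1) (t := {t | 0 ≤ P.eval t}) hpos
        (isClosed_le continuous_const P.continuous) ht
    · right
      push Not at hpos
      obtain ⟨s, hs, hs0⟩ := hpos
      have hneg : ∀ t ∈ Ioo (-1 : ℝ) 1, P.eval t ≤ 0 := by
        intro t ht
        by_contra hlt
        push Not at hlt
        obtain ⟨c, hc, hc0⟩ := isPreconnected_Ioo.intermediate_value hs ht
          (P.continuous.continuousOn) ⟨hs0.le, hlt.le⟩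
        exact hP c hc hc0
      rw [← hcl]
      exact fun t ht => closure_minimal (s := Ioo (-1 : ℝ) 1) (t := {t | P.eval t ≤ 0}) hneg
        (isClosed_le P.continuous continuous_const) ht
  induction m with
  | zero =>
    intro P hP hd
    obtain ⟨c, rfl⟩ : ∃ c, P = C c := ⟨_, eq_C_of_natDegree_le_zero hd⟩
    refine ⟨∅, by simp, ?_⟩
    rcases le_total 0 c with h | h
    · left; intro t _; simpa using h
    · right; intro t _; simpa using h
  | succ m ih =>
    intro P hP hd
    by_cases hr : ∃ z ∈ Ioo (-1 : ℝ) 1, P.IsRoot z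
    · obtain ⟨z, hz, hroot⟩ := hr
      obtain ⟨P₁, rfl⟩ := dvd_iff_isRoot.mpr hroot
      have hP₁ : P₁ ≠ 0 := right_ne_zero_of_mul hP
      rw [natDegree_mul (X_sub_C_ne_zero z) hP₁, natDegree_X_sub_C] at hd
      obtain ⟨Z, hZ, hsign⟩ := ih P₁ hP₁ (by omega)
      -- Extracting a root toggles its membership, so Z ends up as the set of roots of odd
      -- multiplicity.
      by_cases hzZ : z ∈ Z
      · refine ⟨Z.erase z, fun w hw => ?_, ?_⟩
        · have := hZ w (Finset.mem_of_mem_erase hw)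
          exact ⟨this.1, by rw [IsRoot.def, eval_mul, this.2.eq_zero, mul_zero]⟩
        · have : ∀ t : ℝ, ((X - C z) * P₁).eval t * ∏ w ∈ Z.erase z, (t - w) =
              P₁.eval t * ∏ w ∈ Z, (t - w) := by
            intro t
            rw [← Finset.mul_prod_erase Z _ hzZ]; simp; ring
          simpa only [this] using hsign
      · refine ⟨insert z Z, fun w hw => ?_, ?_⟩
        · rcases Finset.mem_insert.mp hw with rfl | hw
          · exact ⟨hz, hroot⟩
          · have := hZ w hw
            exact ⟨this.1, by rw [IsRoot.def, eval_mul, this.2.eq_zero, mul_zero]⟩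
        · have : ∀ t : ℝ, ((X - C z) * P₁).eval t * ∏ w ∈ insert z Z, (t - w) =
              (t - z) ^ 2 * (P₁.eval t * ∏ w ∈ Z, (t - w)) := by
            intro t
            rw [Finset.prod_insert hzZ]; simp; ring
          simp only [this]
          rcases hsign with h | h
          · exact Or.inl fun t ht => mul_nonneg (sq_nonneg _) (h t ht)
          · exact Or.inr fun t ht => mul_nonpos_of_nonneg_of_nonpos (sq_nonneg _) (h t ht)
    · push Not at hr
      refine ⟨∅, by simp, ?_⟩
      simpa using noroot P hr

/-- The divided differences of `f` integrate against a polynomial orthogonal to lower degrees as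
against its leading monomial. -/
theorem exists_finset_abs_sum_slope_le {ι : Type*} (S : Finset ι) (t ν : ι → ℝ)
    (ht : ∀ i ∈ S, t i ∈ Icc (-1 : ℝ) 1) (hν : ∀ i ∈ S, 0 ≤ ν i) {n : ℕ}
    (hcard : n < ((S.filter fun i => 0 < ν i).image t).card) {V : ℝ[X]} (hV0 : V ≠ 0)
    (hV : V.natDegree ≤ n)
    (horth : ∀ r : ℝ[X], r.natDegree < n → ∑ i ∈ S, ν i * V.eval (t i) * r.eval (t i) = 0) :
    ∃ Z : Finset ℝ, ∀ x ∈ Icc (-1 : ℝ) 1, x ∉ Z → ∀ (f : ℝ → ℝ) (M : ℝ),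
      ContDiffOn ℝ ((n + 1 : ℕ) : WithTop ℕ∞) f (Icc (-1) 1) →
      (∀ ξ ∈ Icc (-1 : ℝ) 1, |iteratedDerivWithin (n + 1) f (Icc (-1) 1) ξ| ≤ M) →
      |∑ i ∈ S, ν i * V.eval (t i) * ((f x - f (t i)) / (x - t i))| ≤
        M / (n + 1).factorial * |∑ i ∈ S, ν i * V.eval (t i) * t i ^ n| := by
  obtain ⟨Z, hZ, hsign⟩ := exists_finset_roots_mul_prod_sign n V hV0 hV
  set W : ℝ[X] := ∏ z ∈ Z, (X - C z) with hW
  have hWev : ∀ y, W.eval y = ∏ z ∈ Z, (y - z) := fun y => by simp [hW, eval_prod]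
  have hWm : W.Monic := monic_prod_X_sub_C (fun z => z) Z
  have hWd : W.natDegree = Z.card := by
    rw [hW, natDegree_prod_of_monic _ _ fun z _ => monic_X_sub_C z]; simp
  have hroots : V.roots.toFinset.card ≤ n :=
    (Multiset.toFinset_card_le _).trans ((card_roots' V).trans hV)
  have hZle : Z.card ≤ n := by
    refine (Finset.card_le_card fun z hz => ?_).trans hroots
    simpa [hV0] using (hZ z hz).2
  have habs : ∑ i ∈ S, |ν i * V.eval (t i) * W.eval (t i)| =
      |∑ i ∈ S, ν i * V.eval (t i) * W.eval (t i)| := by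
    rcases hsign with h | h
    · have h' : ∀ i ∈ S, 0 ≤ ν i * V.eval (t i) * W.eval (t i) := fun i hi => by
        rw [mul_assoc, hWev]; exact mul_nonneg (hν i hi) (h _ (ht i hi))
      rw [abs_of_nonneg (Finset.sum_nonneg h')]
      exact Finset.sum_congr rfl fun i hi => abs_of_nonneg (h' i hi)
    · have h' : ∀ i ∈ S, ν i * V.eval (t i) * W.eval (t i) ≤ 0 := fun i hi => by
        rw [mul_assoc, hWev]; exact mul_nonpos_of_nonneg_of_nonpos (hν i hi) (h _ (ht i hi))
      rw [abs_of_nonpos (Finset.sum_nonpos h'), ← Finset.sum_neg_distrib]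
      exact Finset.sum_congr rfl fun i hi => abs_of_nonpos (h' i hi)
  have hZn : Z.card = n := by
    -- With fewer than n sign changes W would be orthogonal to V, so VW, being of constant sign,
    -- would vanish at every node of positive weight. These exceed n in number, too many roots for
    -- V.
    refine le_antisymm hZle (not_lt.mp fun hlt => ?_)
    have h0 := horth W (by omega)
    rw [h0, abs_zero, Finset.sum_eq_zero_iff_of_nonneg fun i _ => abs_nonneg _] at habs
    refine absurd (hcard.trans_le ((Finset.card_le_card ?_).trans hroots)) (lt_irrefl _)
    intro y hy
    obtain ⟨i, hi, rfl⟩ := Finset.mem_image.mp hy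
    obtain ⟨hiS, hνi⟩ := Finset.mem_filter.mp hi
    have h1 := abs_eq_zero.mp (habs i hiS)
    have hroot : V.eval (t i) = 0 := by
      rcases mul_eq_zero.mp h1 with h2 | h2
      · exact (mul_eq_zero.mp h2).resolve_left hνi.ne'
      · rw [hWev] at h2
        obtain ⟨z, hz, hzt⟩ := Finset.prod_eq_zero_iff.mp h2
        rw [sub_eq_zero.mp hzt]; exact (hZ z hz).2
    simpa [hV0] using hroot
  have hlead : ∑ i ∈ S, ν i * V.eval (t i) * W.eval (t i) =
      ∑ i ∈ S, ν i * V.eval (t i) * t i ^ n := by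
    rw [← sub_eq_zero, ← Finset.sum_sub_distrib]
    rcases Nat.eq_zero_or_pos n with hn | hn
    · have : Z = ∅ := Finset.card_eq_zero.mp (by omega)
      simp [hW, this, hn]
    · rw [← horth (W - X ^ n)]
      · exact Finset.sum_congr rfl fun i _ => by simp; ring
      · by_cases h0 : W - X ^ n = 0
        · rw [h0]; simpa using hn
        · rw [natDegree_lt_iff_degree_lt h0]
          have hdn : W.degree = n := by rw [degree_eq_natDegree hWm.ne_zero, hWd, hZn]
          rw [← hdn]
          refine degree_sub_lt_left (by simp [hdn]) hWm.ne_zero ?_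
          rw [hWm.leadingCoeff, leadingCoeff_X_pow]
  -- Outside Z, x is a new interpolation node; outside the grid, the difference quotients have
  -- nonzero denominators.
  refine ⟨Z ∪ S.image t, fun x hx hxZ f M hf hM => ?_⟩
  have hxZ' : x ∉ Z := fun h => hxZ (Finset.mem_union_left _ h)
  have hxt : ∀ i ∈ S, x - t i ≠ 0 := fun i hi h => hxZ
    (Finset.mem_union_right _ (Finset.mem_image.mpr ⟨i, hi, (sub_eq_zero.mp h).symm⟩))
  set s : Finset ℝ := insert x Z with hs
  have hscard : s.card = n + 1 := by rw [hs, Finset.card_insert_of_notMem hxZ', hZn]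
  set I : ℝ[X] := Lagrange.interpolate s id f with hI
  have hinj : Set.InjOn (id : ℝ → ℝ) s := Function.injective_id.injOn
  have hId : I.natDegree ≤ n := by
    have := Lagrange.degree_interpolate_lt f hinj
    rw [hscard] at this
    exact natDegree_le_of_degree_le (Order.le_of_lt_succ (by exact_mod_cast this))
  have hIs : ∀ z ∈ s, I.eval z = f z := fun z hz => Lagrange.eval_interpolate_at_node f hinj hz
  have hIx : I.eval x = f x := hIs x (Finset.mem_insert_self _ _)
  -- The difference quotient of I is a polynomial of degree less than n, hence orthogonal to V.
  have hIsum : ∑ i ∈ S, ν i * V.eval (t i) * ((I.eval x - I.eval (t i)) / (x - t i)) = 0 := by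
    rcases Nat.eq_zero_or_pos n with hn | hn
    · rw [eq_C_of_natDegree_le_zero (p := I) (by omega)]; simp
    · rw [← horth (I /ₘ (X - C x))
        (by rw [natDegree_divByMonic _ (monic_X_sub_C x), natDegree_X_sub_C]; omega)]
      refine Finset.sum_congr rfl fun i hi => ?_
      have h1 := congrArg (eval (t i)) (modByMonic_add_div I (X - C x))
      rw [modByMonic_X_sub_C_eq_C_eval] at h1
      simp only [eval_add, eval_C, eval_mul, eval_sub, eval_X] at h1
      rw [← h1]
      have := hxt i hi
      field_simp
      ring
  have hrepl : ∑ i ∈ S, ν i * V.eval (t i) * ((f x - f (t i)) / (x - t i)) =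
      ∑ i ∈ S, ν i * V.eval (t i) * ((I.eval (t i) - f (t i)) / (x - t i)) := by
    rw [← sub_zero (∑ i ∈ S, ν i * V.eval (t i) * ((f x - f (t i)) / (x - t i))), ← hIsum,
      ← Finset.sum_sub_distrib, hIx]
    exact Finset.sum_congr rfl fun i _ => by ring
  have hfac : (0 : ℝ) < (n + 1).factorial := by exact_mod_cast Nat.factorial_pos _
  rw [hrepl, ← hlead, ← habs, Finset.mul_sum]
  refine (Finset.abs_sum_le_sum_abs _ _).trans (Finset.sum_le_sum fun i hi => ?_)
  -- The node polynomial is (t - x) W(t); its first factor cancels the denominator of the quotient.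
  have herr := abs_sub_eval_le_prod hf hM s hscard (by
    intro z hz
    rcases Finset.mem_insert.mp hz with rfl | hz
    · exact hx
    · exact Ioo_subset_Icc_self (hZ z hz).1) hId hIs (ht i hi)
  rw [hs, Finset.prod_insert hxZ', ← hWev, abs_mul, abs_sub_comm (t i) x] at herr
  have hpos : 0 < |x - t i| := abs_pos.mpr (hxt i hi)
  rw [abs_mul, abs_div, abs_mul _ (W.eval (t i)), abs_sub_comm (I.eval (t i))]
  have h2 : |f (t i) - I.eval (t i)| / |x - t i| ≤ M / (n + 1).factorial * |W.eval (t i)| := by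
    rw [div_le_iff₀ hpos]; calc _ ≤ _ := herr
      _ = _ := by ring
  calc |ν i * V.eval (t i)| * (|f (t i) - I.eval (t i)| / |x - t i|)
      ≤ |ν i * V.eval (t i)| * (M / (n + 1).factorial * |W.eval (t i)|) :=
        mul_le_mul_of_nonneg_left h2 (abs_nonneg _)
    _ = _ := by ring

/-! ### Symmetric three-term recurrences normalized at 1 -/

noncomputable section

/-- Polynomials with `q 0 = 1`, `q 1 = X` and `X * q k = a k * q (k + 1) + (1 - a k) * q (k - 1)`. -/
def walkPoly (a : ℕ → ℝ) : ℕ → ℝ[X]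
  | 0 => 1
  | 1 => X
  | k + 2 => C (a (k + 1))⁻¹ * (X * walkPoly a (k + 1) - C (1 - a (k + 1)) * walkPoly a k)

variable {a : ℕ → ℝ}

theorem walkPoly_rec {k : ℕ} (ha : a (k + 1) ≠ 0) (x : ℝ) :
    x * (walkPoly a (k + 1)).eval x =
      a (k + 1) * (walkPoly a (k + 2)).eval x + (1 - a (k + 1)) * (walkPoly a k).eval x := by
  simp only [walkPoly, eval_mul, eval_C, eval_sub, eval_X]
  field_simp
  ring

theorem walkPoly_eval_one (k : ℕ) : (∀ j, 1 ≤ j → j < k → a j ≠ 0) → (walkPoly a k).eval 1 = 1 := by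
  induction k using Nat.twoStepInduction with
  | zero => intro _; simp [walkPoly]
  | one => intro _; simp [walkPoly]
  | more k ih1 ih2 =>
    intro h
    have hk := h (k + 1) (by omega) (by omega)
    simp only [walkPoly, eval_mul, eval_C, eval_sub, eval_X]
    rw [ih1 fun j h1 h2 => h j h1 (by omega), ih2 fun j h1 h2 => h j h1 (by omega)]
    field_simp
    ring

theorem walkPoly_eval_neg (k : ℕ) (x : ℝ) :
    (walkPoly a k).eval (-x) = (-1) ^ k * (walkPoly a k).eval x := by
  induction k using Nat.twoStepInduction with
  | zero => simp [walkPoly]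
  | one => simp [walkPoly]
  | more k ih1 ih2 =>
    simp only [walkPoly, eval_mul, eval_C, eval_sub, eval_X]
    rw [ih1, ih2, pow_succ, pow_succ]
    ring

theorem walkPoly_natDegree_le (k : ℕ) : (walkPoly a k).natDegree ≤ k := by
  induction k using Nat.twoStepInduction with
  | zero => simp [walkPoly]
  | one => simp [walkPoly]
  | more k ih1 ih2 =>
    rw [walkPoly]
    refine (natDegree_C_mul_le _ _).trans ((natDegree_sub_le _ _).trans (max_le ?_ ?_))
    · exact natDegree_mul_le.trans (by rw [natDegree_X]; omega)
    · exact (natDegree_C_mul_le _ _).trans (by omega)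

theorem walkPoly_coeff (ha0 : a 0 = 1) (k : ℕ) :
    (walkPoly a k).coeff k = ∏ j ∈ Finset.range k, (a j)⁻¹ := by
  induction k using Nat.twoStepInduction with
  | zero => simp [walkPoly]
  | one => simp [walkPoly, ha0]
  | more k ih1 ih2 =>
    rw [walkPoly, coeff_C_mul, coeff_sub, coeff_X_mul, coeff_C_mul, ih2,
      coeff_eq_zero_of_natDegree_lt ((walkPoly_natDegree_le k).trans_lt (by omega : k < k + 2)),
      Finset.prod_range_succ _ (k + 1)]
    ring

/-- `|q k| ≤ 1` on `[-1, 1]` as long as the coefficients are at least `1 / 2`. -/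
theorem abs_walkPoly_eval_le_one {n : ℕ} (ha : ∀ j, 1 ≤ j → j ≤ n → 1 / 2 ≤ a j) {x : ℝ}
    (hx : x ∈ Icc (-1 : ℝ) 1) {k : ℕ} (hk : k ≤ n + 1) : |(walkPoly a k).eval x| ≤ 1 := by
  have hx2 : 0 ≤ 1 - x ^ 2 := by nlinarith [hx.1, hx.2]
  -- The left side is the symmetric form q_{k+1}² - 2x q_k q_{k+1} + q_k². It is constant for
  -- Chebyshev polynomials (a = 1/2) and nonincreasing when a ≥ 1/2, because then (1 - a)² ≤ a².
  have key : ∀ k ≤ n, ((walkPoly a (k + 1)).eval x - x * (walkPoly a k).eval x) ^ 2 +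
      (1 - x ^ 2) * (walkPoly a k).eval x ^ 2 ≤ 1 - x ^ 2 := by
    intro k
    induction k with
    | zero => intro _; simp [walkPoly]
    | succ k ih =>
      intro hk
      have h1 := ih (by omega)
      have hak := ha (k + 1) (by omega) hk
      have hrec := walkPoly_rec (a := a) (k := k) (by linarith) x
      set p := (walkPoly a k).eval x
      set q := (walkPoly a (k + 1)).eval x
      set r := (walkPoly a (k + 1 + 1)).eval x
      set b := a (k + 1)
      have h2 : b * (r - x * q) = -((1 - b) * (p - x * q)) := by
        change x * q = b * r + (1 - b) * p at hrec
        linear_combination -hrec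
      have h3 : b ^ 2 * (r - x * q) ^ 2 = (1 - b) ^ 2 * (p - x * q) ^ 2 := by
        rw [← mul_pow, h2]; ring
      have h4 : b ^ 2 * (r - x * q) ^ 2 ≤ b ^ 2 * (p - x * q) ^ 2 := by
        rw [h3]
        exact mul_le_mul_of_nonneg_right (by nlinarith) (sq_nonneg _)
      have h5 : (r - x * q) ^ 2 ≤ (p - x * q) ^ 2 :=
        le_of_mul_le_mul_left h4 (by positivity)
      linarith
  -- At x = ±1 the form inequality no longer bounds q_k, so normalization and parity are used there.
  rcases eq_or_lt_of_le hx2 with h0 | hpos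
  · have hxx : x = 1 ∨ x = -1 := by
      have : (x - 1) * (x + 1) = 0 := by linarith
      rcases mul_eq_zero.mp this with h | h
      · left; linarith
      · right; linarith
    have h1 : (walkPoly a k).eval 1 = 1 := walkPoly_eval_one k fun j h1 h2 => by
      have := ha j h1 (by omega)
      linarith
    rcases hxx with rfl | rfl
    · rw [h1]; simp
    · rw [walkPoly_eval_neg, h1]; simp
  · have hsq : (walkPoly a k).eval x ^ 2 ≤ 1 := by
      rcases k with _ | k
      · simp [walkPoly]
      · have h1 := key k (by omega)
        have h2 : (1 - x ^ 2) * (walkPoly a (k + 1)).eval x ^ 2 ≤ (1 - x ^ 2) * 1 := by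
          nlinarith [sq_nonneg ((walkPoly a k).eval x - x * (walkPoly a (k + 1)).eval x)]
        exact le_of_mul_le_mul_left h2 hpos
    exact abs_le_one_iff_mul_self_le_one.mpr (by nlinarith)

section Orthogonal

variable {ι : Type*} {S : Finset ι} {t ω : ι → ℝ} {n : ℕ}

/-- The leading coefficients are nonzero, so q_0, …, q_{k-1} span all polynomials of degree less
than k. -/
theorem walkPoly_sum_mul_eq_zero (ha0 : a 0 = 1) (ha : ∀ j ≤ n, a j ≠ 0)
    (horth : ∀ j k, j < k → k ≤ n + 1 →
      ∑ i ∈ S, ω i * (walkPoly a j).eval (t i) * (walkPoly a k).eval (t i) = 0)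
    {k : ℕ} (hk : k ≤ n + 1) {r : ℝ[X]} (hr : r.natDegree < k) :
    ∑ i ∈ S, ω i * (walkPoly a k).eval (t i) * r.eval (t i) = 0 := by
  have key : ∀ d < k, ∀ r : ℝ[X], r.natDegree ≤ d →
      ∑ i ∈ S, ω i * (walkPoly a k).eval (t i) * r.eval (t i) = 0 := by
    intro d
    induction d with
    | zero =>
      intro hd r hr
      rw [eq_C_of_natDegree_le_zero hr]
      have := horth 0 k hd hk
      simp only [walkPoly, eval_one, mul_one] at this
      simp only [eval_C]
      rw [← Finset.sum_mul, this, zero_mul]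
    | succ d ih =>
      intro hd r hr
      have hc : (walkPoly a (d + 1)).coeff (d + 1) ≠ 0 := by
        rw [walkPoly_coeff ha0]
        refine Finset.prod_ne_zero_iff.mpr fun j hj => inv_ne_zero (ha j ?_)
        have := Finset.mem_range.mp hj
        omega
      set c := r.coeff (d + 1) / (walkPoly a (d + 1)).coeff (d + 1) with hcdef
      have hdeg : (r - C c * walkPoly a (d + 1)).natDegree ≤ d := by
        rw [natDegree_le_iff_coeff_eq_zero]
        intro N hN
        rcases Nat.lt_or_ge (d + 1) N with h | h
        · rw [coeff_sub, coeff_C_mul, coeff_eq_zero_of_natDegree_lt (hr.trans_lt h),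
            coeff_eq_zero_of_natDegree_lt ((walkPoly_natDegree_le _).trans_lt h)]
          ring
        · obtain rfl : N = d + 1 := by omega
          rw [coeff_sub, coeff_C_mul, hcdef, div_mul_cancel₀ _ hc, sub_self]
      have h1 := ih (by omega) _ hdeg
      have h2 := horth (d + 1) k hd hk
      have h3 : ∑ i ∈ S, ω i * (walkPoly a k).eval (t i) * r.eval (t i) =
          ∑ i ∈ S, ω i * (walkPoly a k).eval (t i) * (r - C c * walkPoly a (d + 1)).eval (t i) +
          c * ∑ i ∈ S, ω i * (walkPoly a (d + 1)).eval (t i) * (walkPoly a k).eval (t i) := by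
        rw [Finset.mul_sum, ← Finset.sum_add_distrib]
        exact Finset.sum_congr rfl fun i _ => by simp; ring
      rw [h3, h1, h2]; ring
  exact key r.natDegree hr r le_rfl

/-- The squared norm of `q k`. -/
def walkNorm (a : ℕ → ℝ) (S : Finset ι) (t ω : ι → ℝ) (k : ℕ) : ℝ :=
  ∑ i ∈ S, ω i * (walkPoly a k).eval (t i) ^ 2

/-- Both sides are ⟨t q_k, q_{k+1}⟩, expanded by the recurrence for q_{k+1} and for q_k
respectively. -/
theorem walkNorm_succ (ha0 : a 0 = 1) (ha : ∀ j ≤ n, a j ≠ 0)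
    (horth : ∀ j k, j < k → k ≤ n + 1 →
      ∑ i ∈ S, ω i * (walkPoly a j).eval (t i) * (walkPoly a k).eval (t i) = 0)
    {k : ℕ} (hk : k + 1 ≤ n) :
    a k * walkNorm a S t ω (k + 1) = (1 - a (k + 1)) * walkNorm a S t ω k := by
  have h1 : ∑ i ∈ S, ω i * (walkPoly a k).eval (t i) *
      (t i * (walkPoly a (k + 1)).eval (t i)) = (1 - a (k + 1)) * walkNorm a S t ω k := by
    have h := horth k (k + 2) (by omega) (by omega)
    rw [← zero_add ((1 - a (k + 1)) * _), ← mul_zero (a (k + 1)), ← h, walkNorm, Finset.mul_sum,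
      Finset.mul_sum, ← Finset.sum_add_distrib]
    refine Finset.sum_congr rfl fun i _ => ?_
    rw [walkPoly_rec (ha _ hk)]; ring
  have h2 : ∑ i ∈ S, ω i * (walkPoly a (k + 1)).eval (t i) *
      (t i * (walkPoly a k).eval (t i)) = a k * walkNorm a S t ω (k + 1) := by
    rcases k with _ | k
    · rw [ha0, one_mul, walkNorm]
      exact Finset.sum_congr rfl fun i _ => by simp [walkPoly]; ring
    · have h := horth k (k + 2) (by omega) (by omega)
      rw [← add_zero (a (k + 1) * _), ← mul_zero (1 - a (k + 1)), ← h, walkNorm, Finset.mul_sum,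
        Finset.mul_sum, ← Finset.sum_add_distrib]
      refine Finset.sum_congr rfl fun i _ => ?_
      rw [walkPoly_rec (ha _ (by omega))]; ring
  rw [← h1, ← h2]
  exact Finset.sum_congr rfl fun i _ => by ring

/-- Christoffel-Darboux formula. -/
theorem walkPoly_christoffel_darboux (ha0 : a 0 = 1) (ha : ∀ j ≤ n, a j ≠ 0)
    (horth : ∀ j k, j < k → k ≤ n + 1 →
      ∑ i ∈ S, ω i * (walkPoly a j).eval (t i) * (walkPoly a k).eval (t i) = 0)
    (hnorm : ∀ k ≤ n, walkNorm a S t ω k ≠ 0) (x y : ℝ) {m : ℕ} (hm : m ≤ n) :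
    (x - y) * ∑ k ∈ Finset.range (m + 1),
        (walkPoly a k).eval x * (walkPoly a k).eval y / walkNorm a S t ω k =
      a m / walkNorm a S t ω m * ((walkPoly a (m + 1)).eval x * (walkPoly a m).eval y -
        (walkPoly a m).eval x * (walkPoly a (m + 1)).eval y) := by
  induction m with
  | zero => simp [walkPoly, ha0]; ring
  | succ m ih =>
    rw [Finset.sum_range_succ, mul_add, ih (by omega)]
    have h1 := walkNorm_succ ha0 ha horth hm
    have hx := walkPoly_rec (ha _ hm) x
    have hy := walkPoly_rec (ha _ hm) y
    have n1 := hnorm (m + 1) hm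
    have n0 := hnorm m (by omega)
    -- The norm ratio gives both boundary terms a common denominator, after which the recurrences at
    -- x and y make the sum telescope.
    have h2 : a m / walkNorm a S t ω m = (1 - a (m + 1)) / walkNorm a S t ω (m + 1) := by
      rw [div_eq_div_iff n0 n1, h1]
    rw [h2]
    field_simp
    linear_combination (walkPoly a (m + 1)).eval y * hx - (walkPoly a (m + 1)).eval x * hy

end Orthogonal

end

/-! ### The error bound for a general discrete weight -/

section ErrorBound

variable {a : ℕ → ℝ} {ι : Type*} {S : Finset ι} {t ω : ι → ℝ} {n : ℕ}

/-- Modulo lower degrees, t^n is (a_0⋯a_{n-1}) q_n. -/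
theorem walkPoly_sum_mul_pow (ha0 : a 0 = 1) (ha : ∀ j ≤ n, a j ≠ 0)
    (horth : ∀ j k, j < k → k ≤ n + 1 →
      ∑ i ∈ S, ω i * (walkPoly a j).eval (t i) * (walkPoly a k).eval (t i) = 0) :
    ∑ i ∈ S, ω i * (walkPoly a n).eval (t i) * t i ^ n =
      (∏ j ∈ Finset.range n, a j) * walkNorm a S t ω n := by
  have hc : (walkPoly a n).coeff n * ∏ j ∈ Finset.range n, a j = 1 := by
    rw [walkPoly_coeff ha0, ← Finset.prod_mul_distrib]
    exact Finset.prod_eq_one fun j hj => inv_mul_cancel₀ (ha j (by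
      have := Finset.mem_range.mp hj; omega))
  rcases Nat.eq_zero_or_pos n with hn | hn
  · subst hn; simp [walkPoly, walkNorm]
  · have h0 := walkPoly_sum_mul_eq_zero ha0 ha horth (k := n) (by omega)
      (r := X ^ n - C (∏ j ∈ Finset.range n, a j) * walkPoly a n) (by
        refine Nat.lt_of_le_pred hn (natDegree_le_iff_coeff_eq_zero.mpr fun N hN => ?_)
        rw [Nat.pred_eq_sub_one] at hN
        rcases Nat.lt_or_ge n N with h | h
        · rw [coeff_sub, coeff_C_mul,
            coeff_eq_zero_of_natDegree_lt ((walkPoly_natDegree_le _).trans_lt h), coeff_X_pow,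
            if_neg (by omega)]
          ring
        · obtain rfl : N = n := by omega
          rw [coeff_sub, coeff_C_mul, coeff_X_pow, if_pos rfl]
          linarith)
    rw [walkNorm, Finset.mul_sum, ← sub_eq_zero, ← h0, ← Finset.sum_sub_distrib]
    exact Finset.sum_congr rfl fun i _ => by
      simp only [eval_sub, eval_pow, eval_X, eval_mul, eval_C]; ring

/-- Bound for the divided differences of `f` integrated against `q n - e * q (n + 1)`, which is
orthogonal to polynomials of degree less than `n` and vanishes at the endpoint `e = ± 1`. -/
theorem exists_finset_abs_sum_slope_walkPoly_le (ha0 : a 0 = 1) (ha : ∀ j ≤ n, a j ≠ 0)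
    (ht : ∀ i ∈ S, t i ∈ Icc (-1 : ℝ) 1) (hω : ∀ i ∈ S, 0 ≤ ω i)
    (horth : ∀ j k, j < k → k ≤ n + 1 →
      ∑ i ∈ S, ω i * (walkPoly a j).eval (t i) * (walkPoly a k).eval (t i) = 0)
    (hnorm : 0 < walkNorm a S t ω n) (hprod : 0 < ∏ j ∈ Finset.range n, a j)
    {e : ℝ} (he : e = 1 ∨ e = -1)
    (hcard : n < ((S.filter fun i => 0 < ω i * (1 - e * t i)).image t).card) :
    ∃ Z : Finset ℝ, ∀ x ∈ Icc (-1 : ℝ) 1, x ∉ Z → ∀ (f : ℝ → ℝ) (M : ℝ),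
      ContDiffOn ℝ ((n + 1 : ℕ) : WithTop ℕ∞) f (Icc (-1) 1) →
      (∀ ξ ∈ Icc (-1 : ℝ) 1, |iteratedDerivWithin (n + 1) f (Icc (-1) 1) ξ| ≤ M) →
      |∑ i ∈ S, ω i * ((walkPoly a n).eval (t i) - e * (walkPoly a (n + 1)).eval (t i)) *
          ((f x - f (t i)) / (x - t i))| ≤
        M / (n + 1).factorial * ((∏ j ∈ Finset.range n, a j) * walkNorm a S t ω n) := by
  have hee : e * e = 1 := by rcases he with rfl | rfl <;> norm_num
  have habse : |e| = 1 := by rcases he with rfl | rfl <;> norm_num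
  set p : ℝ[X] := walkPoly a n - C e * walkPoly a (n + 1) with hp
  have hpev : ∀ y, p.eval y = (walkPoly a n).eval y - e * (walkPoly a (n + 1)).eval y := by
    intro y; simp [hp]
  have hroot : p.IsRoot e := by
    have h1 := walkPoly_eval_one (a := a) n fun j _ h2 => ha j (by omega)
    have h2 := walkPoly_eval_one (a := a) (n + 1) fun j _ h2 => ha j (by omega)
    rw [IsRoot.def, hpev]
    rcases he with rfl | rfl
    · rw [h1, h2]; ring
    · rw [walkPoly_eval_neg, walkPoly_eval_neg, h1, h2]; ring
  have hpc : p.coeff (n + 1) ≠ 0 := by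
    rw [hp, coeff_sub, coeff_C_mul, walkPoly_coeff ha0,
      coeff_eq_zero_of_natDegree_lt ((walkPoly_natDegree_le n).trans_lt (Nat.lt_succ_self n)),
      zero_sub, neg_ne_zero]
    refine mul_ne_zero (left_ne_zero_of_mul_eq_one hee)
      (Finset.prod_ne_zero_iff.mpr fun j hj => inv_ne_zero (ha j ?_))
    have := Finset.mem_range.mp hj
    omega
  have hpd : p.natDegree ≤ n + 1 := (natDegree_sub_le _ _).trans
    (max_le ((walkPoly_natDegree_le n).trans n.le_succ)
      ((natDegree_C_mul_le _ _).trans (walkPoly_natDegree_le _)))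
  obtain ⟨V, hV⟩ := dvd_iff_isRoot.mpr hroot
  have hp0 : p ≠ 0 := fun h => hpc (by rw [h, coeff_zero])
  have hV0 : V ≠ 0 := fun h => hp0 (by rw [hV, h, mul_zero])
  have hVd : V.natDegree ≤ n := by
    rw [hV, natDegree_mul (X_sub_C_ne_zero e) hV0, natDegree_X_sub_C] at hpd
    omega
  -- Since e² = 1, t - e = -e(1 - e t), and 1 - e t ≥ 0 can be absorbed into the weight.
  have hpV : ∀ i, ω i * p.eval (t i) = -e * (ω i * (1 - e * t i) * V.eval (t i)) := by
    intro i
    rw [hV, eval_mul, eval_sub, eval_X, eval_C]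
    linear_combination -(ω i * t i * V.eval (t i)) * hee
  have hconv : ∀ g : ι → ℝ, |∑ i ∈ S, ω i * (1 - e * t i) * V.eval (t i) * g i| =
      |∑ i ∈ S, ω i * p.eval (t i) * g i| := by
    intro g
    have : ∑ i ∈ S, ω i * p.eval (t i) * g i =
        -e * ∑ i ∈ S, ω i * (1 - e * t i) * V.eval (t i) * g i := by
      rw [Finset.mul_sum]
      exact Finset.sum_congr rfl fun i _ => by rw [hpV]; ring
    rw [this, abs_mul, abs_neg, habse, one_mul]
  have hporth : ∀ r : ℝ[X], r.natDegree < n → ∑ i ∈ S, ω i * p.eval (t i) * r.eval (t i) = 0 := by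
    intro r hr
    have h1 := walkPoly_sum_mul_eq_zero ha0 ha horth (k := n) (by omega) hr
    have h2 := walkPoly_sum_mul_eq_zero ha0 ha horth (k := n + 1) le_rfl (r := r) (by omega)
    have : ∑ i ∈ S, ω i * p.eval (t i) * r.eval (t i) =
        ∑ i ∈ S, ω i * (walkPoly a n).eval (t i) * r.eval (t i) -
        e * ∑ i ∈ S, ω i * (walkPoly a (n + 1)).eval (t i) * r.eval (t i) := by
      rw [Finset.mul_sum, ← Finset.sum_sub_distrib]
      exact Finset.sum_congr rfl fun i _ => by rw [hpev]; ring
    rw [this, h1, h2]; ring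
  have hppow : ∑ i ∈ S, ω i * p.eval (t i) * t i ^ n =
      (∏ j ∈ Finset.range n, a j) * walkNorm a S t ω n := by
    have h2 := walkPoly_sum_mul_eq_zero ha0 ha horth (k := n + 1) le_rfl (r := X ^ n)
      (by rw [natDegree_X_pow]; omega)
    have : ∑ i ∈ S, ω i * p.eval (t i) * t i ^ n =
        ∑ i ∈ S, ω i * (walkPoly a n).eval (t i) * t i ^ n -
        e * ∑ i ∈ S, ω i * (walkPoly a (n + 1)).eval (t i) * (X ^ n : ℝ[X]).eval (t i) := by
      rw [Finset.mul_sum, ← Finset.sum_sub_distrib]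
      exact Finset.sum_congr rfl fun i _ => by rw [hpev]; simp; ring
    rw [this, h2, walkPoly_sum_mul_pow ha0 ha horth]; ring
  obtain ⟨Z, hZ⟩ := exists_finset_abs_sum_slope_le S t (fun i => ω i * (1 - e * t i)) ht
    (fun i hi => mul_nonneg (hω i hi) (by
      have := ht i hi
      rcases he with rfl | rfl <;> linarith [this.1, this.2])) hcard hV0 hVd (by
    intro r hr
    exact abs_eq_zero.mp (by rw [hconv fun i => r.eval (t i), hporth r hr, abs_zero]))
  refine ⟨Z, fun x hx hxZ f M hf hM => ?_⟩
  have h := hZ x hx hxZ f M hf hM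
  rw [hconv fun i => (f x - f (t i)) / (x - t i), hconv fun i => t i ^ n, hppow,
    abs_of_pos (mul_pos hprod hnorm)] at h
  simpa only [hpev] using h

/-- Error bound for the least-squares approximation with respect to a discrete weight whose
orthogonal polynomials satisfy a symmetric recurrence with coefficients at least `1 / 2`. -/
theorem abs_sub_sum_walkPoly_le (ha0 : a 0 = 1) (ha : ∀ j, 1 ≤ j → j ≤ n → 1 / 2 ≤ a j)
    (ht : ∀ i ∈ S, t i ∈ Icc (-1 : ℝ) 1) (hω : ∀ i ∈ S, 0 ≤ ω i)
    (horth : ∀ j k, j < k → k ≤ n + 1 →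
      ∑ i ∈ S, ω i * (walkPoly a j).eval (t i) * (walkPoly a k).eval (t i) = 0)
    (hnorm : ∀ k ≤ n, 0 < walkNorm a S t ω k)
    (hcard₁ : n < ((S.filter fun i => 0 < ω i * (1 - t i)).image t).card)
    (hcard₂ : n < ((S.filter fun i => 0 < ω i * (1 + t i)).image t).card)
    {f : ℝ → ℝ} {M : ℝ} (hf : ContDiffOn ℝ ((n + 1 : ℕ) : WithTop ℕ∞) f (Icc (-1) 1))
    (hM : ∀ ξ ∈ Icc (-1 : ℝ) 1, |iteratedDerivWithin (n + 1) f (Icc (-1) 1) ξ| ≤ M)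
    {x : ℝ} (hx : x ∈ Icc (-1 : ℝ) 1) :
    |f x - ∑ k ∈ Finset.range (n + 1), (∑ i ∈ S, ω i * f (t i) * (walkPoly a k).eval (t i)) /
        walkNorm a S t ω k * (walkPoly a k).eval x| ≤
      (∏ j ∈ Finset.range (n + 1), a j) / (n + 1).factorial * M := by
  have hapos : ∀ j ≤ n, 0 < a j := fun j hj => by
    rcases Nat.eq_zero_or_pos j with rfl | h
    · rw [ha0]; exact one_pos
    · have := ha j h hj; linarith
  have hane : ∀ j ≤ n, a j ≠ 0 := fun j hj => (hapos j hj).ne'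
  have hprod : 0 < ∏ j ∈ Finset.range n, a j := Finset.prod_pos fun j hj =>
    hapos j (Finset.mem_range.mp hj).le
  obtain ⟨Z₁, hZ₁⟩ := exists_finset_abs_sum_slope_walkPoly_le ha0 hane ht hω horth
    (hnorm n le_rfl) hprod (e := 1) (Or.inl rfl) (by simpa using hcard₁)
  obtain ⟨Z₂, hZ₂⟩ := exists_finset_abs_sum_slope_walkPoly_le ha0 hane ht hω horth
    (hnorm n le_rfl) hprod (e := -1) (Or.inr rfl) (by simpa using hcard₂)
  set E : ℝ → ℝ := fun x => f x - ∑ k ∈ Finset.range (n + 1),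
    (∑ i ∈ S, ω i * f (t i) * (walkPoly a k).eval (t i)) / walkNorm a S t ω k *
      (walkPoly a k).eval x with hE
  set B : ℝ := (∏ j ∈ Finset.range (n + 1), a j) / (n + 1).factorial * M with hB
  set Z : Finset ℝ := Z₁ ∪ Z₂ ∪ S.image t with hZ
  have main : ∀ x ∈ Icc (-1 : ℝ) 1, x ∉ Z → |E x| ≤ B := by
    intro x hx hxZ
    have hxZ₁ : x ∉ Z₁ := fun h => hxZ (by simp [hZ, h])
    have hxZ₂ : x ∉ Z₂ := fun h => hxZ (by simp [hZ, h])
    have hxt : ∀ i ∈ S, x - t i ≠ 0 := fun i hi h => hxZ (by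
      rw [hZ]
      exact Finset.mem_union_right _ (Finset.mem_image.mpr ⟨i, hi, (sub_eq_zero.mp h).symm⟩))
    have hT₁ := hZ₁ x hx hxZ₁ f M hf hM
    have hT₂ := hZ₂ x hx hxZ₂ f M hf hM
    set T₁ := ∑ i ∈ S, ω i * ((walkPoly a n).eval (t i) - 1 * (walkPoly a (n + 1)).eval (t i)) *
      ((f x - f (t i)) / (x - t i))
    set T₂ := ∑ i ∈ S, ω i * ((walkPoly a n).eval (t i) - -1 * (walkPoly a (n + 1)).eval (t i)) *
      ((f x - f (t i)) / (x - t i))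
    set D : ι → ℝ := fun i => ∑ k ∈ Finset.range (n + 1),
      (walkPoly a k).eval x * (walkPoly a k).eval (t i) / walkNorm a S t ω k with hD
    have hcomm : ∀ g : ι → ℝ, ∑ i ∈ S, ω i * g i * D i = ∑ k ∈ Finset.range (n + 1),
        (∑ i ∈ S, ω i * g i * (walkPoly a k).eval (t i)) / walkNorm a S t ω k *
          (walkPoly a k).eval x := by
      intro g
      simp only [hD, Finset.mul_sum, Finset.sum_div, Finset.sum_mul]
      rw [Finset.sum_comm]
      exact Finset.sum_congr rfl fun k _ => Finset.sum_congr rfl fun i _ => by ring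
    -- The kernel reproduces constants, which allows f(x) to be moved inside the sum.
    have hone : ∑ i ∈ S, ω i * 1 * D i = 1 := by
      rw [hcomm fun _ => 1, Finset.sum_range_succ', Finset.sum_eq_zero]
      · have h0 := (hnorm 0 (by omega)).ne'
        have h1 : walkNorm a S t ω 0 = ∑ i ∈ S, ω i := by simp [walkNorm, walkPoly]
        simp only [walkPoly, eval_one, mul_one, zero_add, ← h1]
        exact div_self h0
      · intro k hk
        have := horth 0 (k + 1) (by omega) (by have := Finset.mem_range.mp hk; omega)
        simp only [walkPoly, eval_one, mul_one] at this
        simp only [mul_one]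
        rw [this]; simp
    have hEsum : E x = ∑ i ∈ S, ω i * (f x - f (t i)) * D i := by
      simp only [hE]
      rw [← hcomm fun i => f (t i)]
      calc f x - ∑ i ∈ S, ω i * f (t i) * D i
          = f x * (∑ i ∈ S, ω i * 1 * D i) - ∑ i ∈ S, ω i * f (t i) * D i := by rw [hone, mul_one]
        _ = _ := by
          rw [Finset.mul_sum, ← Finset.sum_sub_distrib]
          exact Finset.sum_congr rfl fun i _ => by ring
    set qx := (walkPoly a n).eval x with hqx
    set rx := (walkPoly a (n + 1)).eval x with hrx
    -- Uses 2(rA - qB) = (q + r)(A - B) - (q - r)(A + B), with A, B the values of q_n, q_{n+1} at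
    -- the nodes.
    have hEq : E x = a n / walkNorm a S t ω n / 2 * ((qx + rx) * T₁ - (qx - rx) * T₂) := by
      rw [hEsum, Finset.mul_sum, Finset.mul_sum, ← Finset.sum_sub_distrib, Finset.mul_sum]
      refine Finset.sum_congr rfl fun i hi => ?_
      have hcd := walkPoly_christoffel_darboux ha0 hane horth
        (fun k hk => (hnorm k hk).ne') x (t i) le_rfl
      have h0 := hxt i hi
      have hDi : D i = a n / walkNorm a S t ω n * (rx * (walkPoly a n).eval (t i) -
          qx * (walkPoly a (n + 1)).eval (t i)) / (x - t i) := by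
        rw [eq_div_iff h0, ← hcd, mul_comm]
      rw [hDi]
      ring
    have hqx1 : |qx| ≤ 1 := abs_walkPoly_eval_le_one ha hx (by omega)
    have hrx1 : |rx| ≤ 1 := abs_walkPoly_eval_le_one ha hx le_rfl
    have hsum : |qx + rx| + |qx - rx| ≤ 2 := by
      have := abs_le.mp hqx1
      have := abs_le.mp hrx1
      rcases abs_cases (qx + rx) with h | h <;> rcases abs_cases (qx - rx) with h' | h' <;> linarith
    have hn := hnorm n le_rfl
    have han := hapos n le_rfl
    set K := M / (n + 1).factorial * ((∏ j ∈ Finset.range n, a j) * walkNorm a S t ω n) with hK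
    have hK0 : 0 ≤ K := (abs_nonneg _).trans hT₁
    have hBK : B = a n / walkNorm a S t ω n / 2 * (2 * K) := by
      rw [hB, hK, Finset.prod_range_succ]
      field_simp
    rw [hEq, hBK, abs_mul, abs_of_pos (by positivity : 0 < a n / walkNorm a S t ω n / 2)]
    refine mul_le_mul_of_nonneg_left ?_ (by positivity)
    calc |(qx + rx) * T₁ - (qx - rx) * T₂| ≤ |qx + rx| * |T₁| + |qx - rx| * |T₂| := by
          rw [← abs_mul, ← abs_mul]; exact abs_sub _ _
      _ ≤ |qx + rx| * K + |qx - rx| * K := by gcongr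
      _ = (|qx + rx| + |qx - rx|) * K := by ring
      _ ≤ 2 * K := mul_le_mul_of_nonneg_right hsum hK0
  have hcont : ContinuousOn E (Icc (-1) 1) := by
    refine hf.continuousOn.sub (Continuous.continuousOn ?_)
    exact continuous_finsetSum _ fun k _ => continuous_const.mul (walkPoly a k).continuous
  -- The finitely many excluded points are recovered by continuity of the error.
  have hdense : x ∈ closure (Ioo (-1 : ℝ) 1 \ Z) := by
    have h1 : Dense ((Z : Set ℝ)ᶜ) := Z.countable_toSet.dense_compl ℝ
    have h2 := h1.open_subset_closure_inter (isOpen_Ioo (a := (-1 : ℝ)) (b := 1))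
    have h3 : closure (Ioo (-1 : ℝ) 1) = Icc (-1) 1 := closure_Ioo (by norm_num)
    rw [← h3] at hx
    exact closure_minimal h2 isClosed_closure hx
  have hmem : ∀ y ∈ Ioo (-1 : ℝ) 1 \ Z, |E y| ≤ B := fun y hy =>
    main y (Ioo_subset_Icc_self hy.1) hy.2
  have := (hcont x hx).mono (show Ioo (-1 : ℝ) 1 \ (Z : Set ℝ) ⊆ Icc (-1) 1 from
    fun _ hy => Ioo_subset_Icc_self hy.1)
  have hcl := this.mem_closure_image hdense
  have hsub : closure (E '' (Ioo (-1 : ℝ) 1 \ Z)) ⊆ {y | |y| ≤ B} :=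
    closure_minimal (by rintro _ ⟨y, hy, rfl⟩; exact hmem y hy)
      (isClosed_le continuous_abs continuous_const)
  exact hsub hcl

end ErrorBound

/-! ### Symmetric Hahn polynomials: recurrence, orthogonality, constant -/

noncomputable section

theorem poch_zero (a : ℝ) : poch a 0 = 1 := by simp [poch]

theorem poch_succ (a : ℝ) (k : ℕ) : poch a (k + 1) = poch a k * (a + k) := by
  rw [poch, poch, ascPochhammer_succ_eval]

theorem poch_succ_left (a : ℝ) (k : ℕ) : poch a (k + 1) = a * poch (a + 1) k := by
  simp [poch, ascPochhammer_succ_left, eval_comp]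

theorem poch_pos {a : ℝ} (ha : 0 < a) (k : ℕ) : 0 < poch a k := ascPochhammer_pos k a ha

theorem poch_neg_natCast_eq_zero {k j : ℕ} (h : k < j) : poch (-(k : ℝ)) j = 0 :=
  ascPochhammer_eval_neg_coe_nat_of_lt h

theorem poch_neg_natCast_ne_zero {k j : ℕ} (h : j ≤ k) : poch (-(k : ℝ)) j ≠ 0 := by
  intro h0
  obtain ⟨i, hi, h1⟩ := (ascPochhammer_eval_eq_zero_iff j (-(k : ℝ))).mp h0
  rw [neg_neg, Nat.cast_inj] at h1
  omega

/-- The coefficient of `(-x)_j` in the symmetric Hahn polynomial of degree `k`. -/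
def hahnCoeff (α : ℝ) (N k j : ℕ) : ℝ :=
  poch (-(k : ℝ)) j * poch ((k : ℝ) + α + α + 1) j / (poch (α + 1) j * poch (-(N : ℝ)) j) *
    (1 / (Nat.factorial j : ℝ))

theorem hahnCoeff_zero (α : ℝ) (N k : ℕ) : hahnCoeff α N k 0 = 1 := by
  simp [hahnCoeff, poch_zero]

theorem hahnCoeff_eq_zero (α : ℝ) (N : ℕ) {k j : ℕ} (h : k < j) : hahnCoeff α N k j = 0 := by
  simp [hahnCoeff, poch_neg_natCast_eq_zero h]

theorem hahnQ_eq_sum (α : ℝ) (N : ℕ) {k m : ℕ} (h : k + 1 ≤ m) (x : ℝ) :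
    hahnQ α α N k x = ∑ j ∈ Finset.range m, hahnCoeff α N k j * poch (-x) j := by
  rw [← Finset.sum_subset (Finset.range_mono h) fun j _ hj => by
    rw [hahnCoeff_eq_zero α N (by simpa using hj), zero_mul]]
  exact Finset.sum_congr rfl fun j _ => by rw [hahnCoeff]; ring

theorem hahnCoeff_succ {α : ℝ} (hα : -(1 / 2 : ℝ) < α) {N : ℕ} (k : ℕ) {j : ℕ} (hj : j < N) :
    hahnCoeff α N k (j + 1) * ((j + 1) * (α + j + 1) * (j - N)) =
      hahnCoeff α N k j * ((j - k) * (k + 2 * α + 1 + j)) := by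
  have h1 : poch (α + 1) j ≠ 0 := (poch_pos (by linarith) j).ne'
  have h2 := poch_neg_natCast_ne_zero hj.le
  have h3 : (j.factorial : ℝ) ≠ 0 := by positivity
  have h4 : α + 1 + j ≠ 0 := by
    have : (0 : ℝ) ≤ j := j.cast_nonneg
    linarith
  have h5 : -(N : ℝ) + j ≠ 0 := by
    have : (j : ℝ) < N := by exact_mod_cast hj
    linarith
  simp only [hahnCoeff, poch_succ, Nat.factorial_succ]
  push_cast
  field_simp
  ring

/-- The three coefficients of `(-x)_(j+1)` and the coefficient of `(-x)_j` in the three-term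
recurrence. -/
theorem hahnCoeff_rec {α : ℝ} (hα : -(1 / 2 : ℝ) < α) {N k j : ℕ} (hj : j + 1 ≤ N) :
    ((N : ℝ) / 2 - (j + 1)) * hahnCoeff α N (k + 1) (j + 1) + hahnCoeff α N (k + 1) j =
      (k + 2 * α + 2) * (N - k - 1) / (2 * (2 * k + 2 * α + 3)) * hahnCoeff α N (k + 2) (j + 1) +
      (k + 1) * (k + 2 * α + N + 2) / (2 * (2 * k + 2 * α + 3)) * hahnCoeff α N k (j + 1) := by
  have hk : (0 : ℝ) ≤ k := k.cast_nonneg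
  have hk3 : 2 * (2 * (k : ℝ) + 2 * α + 3) ≠ 0 := by linarith
  rw [div_mul_eq_mul_div, div_mul_eq_mul_div, ← add_div, eq_div_iff hk3]
  have hjN : -(N : ℝ) + j ≠ 0 := by
    have : (j : ℝ) + 1 ≤ N := by exact_mod_cast hj
    linarith
  have hjα : α + 1 + j ≠ 0 := by
    have : (0 : ℝ) ≤ j := j.cast_nonneg
    linarith
  have h1 : poch (α + 1) j ≠ 0 := (poch_pos (by linarith) j).ne'
  have h2 := poch_neg_natCast_ne_zero (by omega : j ≤ N)
  have h3 : (j.factorial : ℝ) ≠ 0 := by positivity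
  rcases j with _ | i
  · simp only [hahnCoeff, poch_succ, poch_zero, Nat.factorial_succ, Nat.factorial_zero]
    push_cast at *
    field_simp
    ring
  -- Every Pochhammer symbol depending on k is reduced to (-k)_i or (k+2α+3)_i, leaving a rational
  -- identity. This needs j = i + 1 ≥ 1, hence the separate case j = 0.
  · have e1 : poch (-((k : ℝ) + 2)) (i + 2) = (k + 2) * (k + 1) * poch (-(k : ℝ)) i := by
      rw [poch_succ_left, poch_succ_left, show -((k : ℝ) + 2) + 1 + 1 = -k by ring]; ring
    have e2 : poch (-((k : ℝ) + 1)) (i + 2) = -(k + 1) * (poch (-(k : ℝ)) i * (-k + i)) := by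
      rw [poch_succ_left, show -((k : ℝ) + 1) + 1 = -k by ring, poch_succ]
    have e3 : poch (-((k : ℝ) + 1)) (i + 1) = -(k + 1) * poch (-(k : ℝ)) i := by
      rw [poch_succ_left, show -((k : ℝ) + 1) + 1 = -k by ring]
    have e4 : poch (-(k : ℝ)) (i + 2) = poch (-(k : ℝ)) i * (-k + i) * (-k + i + 1) := by
      rw [poch_succ, poch_succ]; push_cast; ring
    have d1 : poch ((k : ℝ) + α + α + 1) (i + 2) =
        (k + 2 * α + 1) * (k + 2 * α + 2) * poch ((k : ℝ) + 2 * α + 3) i := by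
      rw [poch_succ_left, poch_succ_left,
        show (k : ℝ) + α + α + 1 + 1 + 1 = k + 2 * α + 3 by ring]; ring
    have d2 : poch ((k : ℝ) + 1 + α + α + 1) (i + 2) =
        (k + 2 * α + 2) * (poch ((k : ℝ) + 2 * α + 3) i * (k + 2 * α + 3 + i)) := by
      rw [poch_succ_left, show (k : ℝ) + 1 + α + α + 1 + 1 = k + 2 * α + 3 by ring, poch_succ]
      ring
    have d3 : poch ((k : ℝ) + 1 + α + α + 1) (i + 1) =
        (k + 2 * α + 2) * poch ((k : ℝ) + 2 * α + 3) i := by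
      rw [poch_succ_left, show (k : ℝ) + 1 + α + α + 1 + 1 = k + 2 * α + 3 by ring]
      ring
    have d4 : poch ((k : ℝ) + 2 + α + α + 1) (i + 2) =
        poch ((k : ℝ) + 2 * α + 3) i * (k + 2 * α + 3 + i) * (k + 2 * α + 4 + i) := by
      rw [show (k : ℝ) + 2 + α + α + 1 = k + 2 * α + 3 by ring, poch_succ, poch_succ]
      push_cast; ring
    simp only [hahnCoeff]
    push_cast at *
    rw [e1, e2, e3, e4, d1, d2, d3, d4, poch_succ (α + 1) (i + 1), poch_succ (-(N : ℝ)) (i + 1),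
      Nat.factorial_succ (i + 1)]
    push_cast
    field_simp
    ring

/-- Coefficients are compared in the basis (-x)_j, where (N/2 - x)(-x)_j = (N/2 - j)(-x)_j +
(-x)_{j+1}. -/
theorem hahnQ_rec {α : ℝ} (hα : -(1 / 2 : ℝ) < α) {N k : ℕ} (hk : k + 2 ≤ N) (x : ℝ) :
    ((N : ℝ) / 2 - x) * hahnQ α α N (k + 1) x =
      (k + 2 * α + 2) * (N - k - 1) / (2 * (2 * k + 2 * α + 3)) * hahnQ α α N (k + 2) x +
      (k + 1) * (k + 2 * α + N + 2) / (2 * (2 * k + 2 * α + 3)) * hahnQ α α N k x := by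
  have hk3 : 2 * (k : ℝ) + 2 * α + 3 ≠ 0 := by
    have : (0 : ℝ) ≤ k := k.cast_nonneg
    linarith
  rw [hahnQ_eq_sum α N (by omega : k + 2 + 1 ≤ k + 3), hahnQ_eq_sum α N (by omega : k + 1 ≤ k + 3),
    Finset.sum_range_succ' _ (k + 2), Finset.sum_range_succ' _ (k + 2)]
  have h1 : ((N : ℝ) / 2 - x) * hahnQ α α N (k + 1) x =
      ∑ j ∈ Finset.range (k + 2), ((((N : ℝ) / 2 - (j + 1)) * hahnCoeff α N (k + 1) (j + 1) +
        hahnCoeff α N (k + 1) j) * poch (-x) (j + 1)) + (N : ℝ) / 2 := by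
    have h2 : ((N : ℝ) / 2 - x) * hahnQ α α N (k + 1) x =
        ∑ j ∈ Finset.range (k + 3),
          ((N : ℝ) / 2 - j) * (hahnCoeff α N (k + 1) j * poch (-x) j) +
        ∑ j ∈ Finset.range (k + 2), hahnCoeff α N (k + 1) j * poch (-x) (j + 1) := by
      rw [Finset.sum_range_succ _ (k + 2), hahnCoeff_eq_zero α N (by omega : k + 1 < k + 2),
        hahnQ_eq_sum α N (le_refl (k + 1 + 1)), Finset.mul_sum, zero_mul, mul_zero, add_zero,
        ← Finset.sum_add_distrib]
      exact Finset.sum_congr rfl fun j _ => by rw [poch_succ]; ring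
    rw [h2, Finset.sum_range_succ' _ (k + 2), hahnCoeff_zero, poch_zero, add_right_comm,
      ← Finset.sum_add_distrib]
    congr 1
    · exact Finset.sum_congr rfl fun j _ => by push_cast; ring
    · push_cast; ring
  have hAC : (k + 2 * α + 2) * (N - k - 1) / (2 * (2 * k + 2 * α + 3)) +
      (k + 1) * (k + 2 * α + N + 2) / (2 * (2 * k + 2 * α + 3)) = (N : ℝ) / 2 := by
    rw [← add_div, div_eq_div_iff (mul_ne_zero two_ne_zero hk3) two_ne_zero]
    ring
  have hrec : ∀ j ∈ Finset.range (k + 2), _ := fun j hj =>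
    hahnCoeff_rec (k := k) hα
      (by have := Finset.mem_range.mp hj; omega : j + 1 ≤ N)
  generalize (k + 2 * α + 2) * (N - k - 1) / (2 * (2 * k + 2 * α + 3)) = A at *
  generalize (k + 1) * (k + 2 * α + N + 2) / (2 * (2 * k + 2 * α + 3)) = C at *
  rw [h1, hahnCoeff_zero, hahnCoeff_zero, poch_zero, mul_add, mul_add, add_add_add_comm,
    Finset.mul_sum, Finset.mul_sum, ← Finset.sum_add_distrib]
  congr 1
  · exact Finset.sum_congr rfl fun j hj => by rw [hrec j hj]; ring
  · linear_combination -hAC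

/-- The difference equation of the symmetric Hahn polynomials. -/
theorem hahnQ_difference {α : ℝ} (hα : -(1 / 2 : ℝ) < α) {N k : ℕ} (hk : k ≤ N) (x : ℝ) :
    (x + α + 1) * (N - x) * (hahnQ α α N k (x + 1) - hahnQ α α N k x) -
      x * (N + α + 1 - x) * (hahnQ α α N k x - hahnQ α α N k (x - 1)) =
      -(k * (k + 2 * α + 1)) * hahnQ α α N k x := by
  -- The difference operator is bidiagonal in the basis (-x)_j; `hahnCoeff_succ` then makes the
  -- coefficients those of an eigenvector.
  have hL : ∀ j : ℕ, (x + α + 1) * (N - x) * (poch (-(x + 1)) (j + 1) - poch (-x) (j + 1)) -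
      x * (N + α + 1 - x) * (poch (-x) (j + 1) - poch (-(x - 1)) (j + 1)) =
      -((j + 1) * (j + 1 + 2 * α + 1)) * poch (-x) (j + 1) +
        (j + 1) * (α + j + 1) * (j - N) * poch (-x) j := by
    intro j
    have h1 : poch (-(x + 1)) (j + 1) = -(x + 1) * poch (-x) j := by
      rw [poch_succ_left, show -(x + 1) + 1 = -x by ring]
    have h2 : x * poch (-(x - 1)) (j + 1) = -(poch (-x) j * (-x + j) * (-x + j + 1)) := by
      have := poch_succ_left (-x) (j + 1)
      rw [poch_succ, poch_succ, show -x + 1 = -(x - 1) by ring] at this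
      push_cast at this
      linear_combination this
    rw [h1, poch_succ (-x)]
    linear_combination (N + α + 1 - x) * h2
  have hsum : (x + α + 1) * (N - x) * (hahnQ α α N k (x + 1) - hahnQ α α N k x) -
      x * (N + α + 1 - x) * (hahnQ α α N k x - hahnQ α α N k (x - 1)) =
      ∑ j ∈ Finset.range k, hahnCoeff α N k (j + 1) *
        (-((j + 1) * (j + 1 + 2 * α + 1)) * poch (-x) (j + 1) +
          (j + 1) * (α + j + 1) * (j - N) * poch (-x) j) := by
    simp only [hahnQ_eq_sum α N (le_refl (k + 1)), Finset.sum_range_succ' _ k, poch_zero]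
    rw [add_sub_add_right_eq_sub, add_sub_add_right_eq_sub, ← Finset.sum_sub_distrib,
      ← Finset.sum_sub_distrib, Finset.mul_sum, Finset.mul_sum, ← Finset.sum_sub_distrib]
    refine Finset.sum_congr rfl fun j _ => ?_
    rw [← hL]; ring
  have hA : ∑ j ∈ Finset.range k, hahnCoeff α N k (j + 1) *
        (-((j + 1) * (j + 1 + 2 * α + 1)) * poch (-x) (j + 1)) =
      ∑ j ∈ Finset.range (k + 1), -(j * (j + 2 * α + 1)) * (hahnCoeff α N k j * poch (-x) j) := by
    rw [Finset.sum_range_succ']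
    simp only [Nat.cast_zero, zero_mul, neg_zero, add_zero]
    exact Finset.sum_congr rfl fun j _ => by push_cast; ring
  have hB : ∑ j ∈ Finset.range k, hahnCoeff α N k (j + 1) *
        ((j + 1) * (α + j + 1) * (j - N) * poch (-x) j) =
      ∑ j ∈ Finset.range (k + 1),
        (j - k) * (k + 2 * α + 1 + j) * (hahnCoeff α N k j * poch (-x) j) := by
    rw [Finset.sum_range_succ, sub_self, zero_mul, zero_mul, add_zero]
    refine Finset.sum_congr rfl fun j hj => ?_
    have := hahnCoeff_succ hα k (lt_of_lt_of_le (Finset.mem_range.mp hj) hk)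
    linear_combination poch (-x) j * this
  rw [hsum]
  simp only [mul_add (hahnCoeff _ _ _ _)]
  rw [Finset.sum_add_distrib, hA, hB, ← Finset.sum_add_distrib,
    hahnQ_eq_sum α N (le_refl (k + 1)), Finset.mul_sum]
  exact Finset.sum_congr rfl fun j _ => by ring

theorem ring_choose_eq_poch (α : ℝ) (i : ℕ) :
    Ring.choose (α + i) i = poch (α + 1) i / i.factorial := by
  have h1 := Ring.factorial_nsmul_multichoose_eq_ascPochhammer (α + 1) i
  rw [Ring.multichoose_eq, ascPochhammer_smeval_eq_eval,
    show α + 1 + (i : ℝ) - 1 = α + i by ring, nsmul_eq_mul] at h1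
  rw [eq_div_iff (by positivity), mul_comm, h1, poch]

theorem hahnWeight_eq_poch (α : ℝ) {N i : ℕ} (hi : i ≤ N) : hahnWeight α α N i =
    poch (α + 1) i / i.factorial * (poch (α + 1) (N - i) / (N - i).factorial) := by
  rw [hahnWeight, ring_choose_eq_poch, ← ring_choose_eq_poch α (N - i), Nat.cast_sub hi,
    add_sub_assoc]

theorem hahnWeight_pos {α : ℝ} (hα : -(1 / 2 : ℝ) < α) {N i : ℕ} (hi : i ≤ N) :
    0 < hahnWeight α α N i := by
  rw [hahnWeight_eq_poch α hi]
  have h1 := poch_pos (by linarith : 0 < α + 1) i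
  have h2 := poch_pos (by linarith : 0 < α + 1) (N - i)
  positivity

/-- The Pearson equation of the weight, which makes the difference operator self-adjoint. -/
theorem hahnWeight_succ (α : ℝ) {N i : ℕ} (hi : i < N) :
    hahnWeight α α N (i + 1) * ((i + 1) * (N + α - i)) =
      hahnWeight α α N i * ((i + α + 1) * (N - i)) := by
  obtain ⟨m, rfl⟩ := Nat.exists_eq_add_of_lt hi
  rw [hahnWeight_eq_poch α (by omega), hahnWeight_eq_poch α (by omega),
    show i + m + 1 - (i + 1) = m by omega, show i + m + 1 - i = m + 1 by omega,
    poch_succ, poch_succ, Nat.factorial_succ, Nat.factorial_succ]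
  push_cast
  field_simp
  ring

/-- Discrete Sturm-Liouville argument: partial sums times the eigenvalue difference telescope to a
Casoratian. The boundary terms vanish through the factors x at 0 and N - x at N, and the eigenvalues
are distinct. -/
theorem hahnInner_hahnQ_eq_zero {α : ℝ} (hα : -(1 / 2 : ℝ) < α) {N j k : ℕ} (hjk : j < k)
    (hk : k ≤ N) : hahnInner α α N (hahnQ α α N j) (hahnQ α α N k) = 0 := by
  set y := hahnQ α α N j with hy
  set z := hahnQ α α N k with hz
  have htel : ∀ m ≤ N, ∑ i ∈ Finset.range m, (y i * z i * hahnWeight α α N i) *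
      ((k * (k + 2 * α + 1) - j * (j + 2 * α + 1) : ℝ)) =
      hahnWeight α α N m * (m * (N + α + 1 - m)) * (z (m - 1) * y m - y (m - 1) * z m) := by
    intro m
    induction m with
    | zero => intro _; simp
    | succ m ih =>
      intro hm
      rw [Finset.sum_range_succ, ih (by omega)]
      have h1 := hahnQ_difference hα (by omega : j ≤ N) (m : ℝ)
      have h2 := hahnQ_difference hα hk (m : ℝ)
      rw [← hy] at h1
      rw [← hz] at h2
      have h3 := hahnWeight_succ α (by omega : m < N)
      push_cast
      rw [add_sub_cancel_right]
      linear_combination -(hahnWeight α α N m * (z m * h1 - y m * h2)) -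
        (z m * y (m + 1) - y m * z (m + 1)) * h3
  have hlast : hahnInner α α N y z * ((k * (k + 2 * α + 1) - j * (j + 2 * α + 1) : ℝ)) = 0 := by
    rw [hahnInner, Finset.sum_mul, Finset.sum_range_succ, htel N le_rfl]
    have h1 := hahnQ_difference hα (by omega : j ≤ N) (N : ℝ)
    have h2 := hahnQ_difference hα hk (N : ℝ)
    rw [← hy] at h1
    rw [← hz] at h2
    linear_combination -(hahnWeight α α N N * (z N * h1 - y N * h2))
  refine (mul_eq_zero.mp hlast).resolve_right ?_
  have hjk' : (j : ℝ) + 1 ≤ k := by exact_mod_cast hjk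
  have hj0 : (0 : ℝ) ≤ j := j.cast_nonneg
  have : (k : ℝ) * (k + 2 * α + 1) - j * (j + 2 * α + 1) = (k - j) * (k + j + 2 * α + 1) := by ring
  rw [this]
  exact (mul_pos (by linarith) (by linarith)).ne'

/-- The recurrence coefficients of the symmetric Hahn polynomials in the variable `1 - 2 x / N`. -/
def hahnRecCoeff (α : ℝ) (N k : ℕ) : ℝ :=
  (k + 2 * α + 1) * (N - k) / (N * (2 * k + 2 * α + 1))

theorem hahnRecCoeff_zero {α : ℝ} (hα : -(1 / 2 : ℝ) < α) {N : ℕ} (hN : 1 ≤ N) :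
    hahnRecCoeff α N 0 = 1 := by
  have h1 : (N : ℝ) ≠ 0 := by positivity
  have h2 : 2 * 0 + 2 * α + 1 ≠ 0 := by linarith
  simp only [hahnRecCoeff, Nat.cast_zero]
  rw [div_eq_one_iff_eq (mul_ne_zero h1 h2)]
  ring

theorem hahnRecCoeff_pos {α : ℝ} (hα : -(1 / 2 : ℝ) < α) {N k : ℕ} (hk : k < N) :
    0 < hahnRecCoeff α N k := by
  have h1 : (0 : ℝ) ≤ k := k.cast_nonneg
  have h2 : (k : ℝ) < N := by exact_mod_cast hk
  exact div_pos (mul_pos (by linarith) (by linarith)) (mul_pos (by linarith) (by linarith))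

theorem hahnQ_eq_walkPoly {α : ℝ} (hα : -(1 / 2 : ℝ) < α) {N : ℕ} (hN : 1 ≤ N) (x : ℝ) (k : ℕ) :
    k ≤ N → hahnQ α α N k x = (walkPoly (hahnRecCoeff α N) k).eval (1 - 2 * x / N) := by
  have hN0 : (N : ℝ) ≠ 0 := by positivity
  induction k using Nat.twoStepInduction with
  | zero => intro _; simp [hahnQ, walkPoly, poch_zero]
  | one =>
    intro _
    have h1 : α + 1 ≠ 0 := by linarith
    simp only [hahnQ, walkPoly, Finset.sum_range_succ, Finset.sum_range_zero, poch_succ, poch_zero,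
      eval_X, Nat.factorial]
    push_cast
    simp only [one_mul, add_zero, zero_add, div_one, mul_one]
    field_simp
    ring
  | more k ih1 ih2 =>
    intro hk
    have hrec := hahnQ_rec hα hk x
    have ha := hahnRecCoeff_pos hα (by omega : k + 1 < N)
    have hw := walkPoly_rec (a := hahnRecCoeff α N) (k := k) ha.ne' (1 - 2 * x / N)
    rw [← ih1 (by omega), ← ih2 (by omega)] at hw
    have hk3 : 2 * (k : ℝ) + 2 * α + 3 ≠ 0 := by
      have : (0 : ℝ) ≤ k := k.cast_nonneg
      linarith
    have hA : (k + 2 * α + 2) * (N - k - 1) / (2 * (2 * k + 2 * α + 3)) =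
        N / 2 * hahnRecCoeff α N (k + 1) := by
      rw [hahnRecCoeff]; push_cast
      rw [show 2 * ((k : ℝ) + 1) + 2 * α + 1 = 2 * k + 2 * α + 3 by ring]
      field_simp
      ring
    have hC : (k + 1) * (k + 2 * α + N + 2) / (2 * (2 * k + 2 * α + 3)) =
        N / 2 * (1 - hahnRecCoeff α N (k + 1)) := by
      rw [mul_sub, ← hA, eq_sub_iff_add_eq, ← add_div, mul_one,
        div_eq_div_iff (mul_ne_zero two_ne_zero hk3) two_ne_zero]
      ring
    rw [hA, hC] at hrec
    have h1 : (N : ℝ) / 2 - x = N / 2 * (1 - 2 * x / N) := by field_simp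
    rw [h1] at hrec
    have h2 : (N : ℝ) / 2 * (hahnRecCoeff α N (k + 1)) ≠ 0 := mul_ne_zero (by simpa using hN0) ha.ne'
    refine mul_left_cancel₀ h2 ?_
    linear_combination -hrec + (N : ℝ) / 2 * hw

/-- The theorem's variable is the negative of 1 - 2x/N, whence the parity sign; it cancels in each
term of the least-squares expansion. -/
theorem hahnQ_grid_eq_walkPoly {α : ℝ} (hα : -(1 / 2 : ℝ) < α) {N : ℕ} (hN : 1 ≤ N) (t : ℝ)
    {k : ℕ} (hk : k ≤ N) : hahnQ α α N k (N / 2 * (1 + t)) =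
      (-1) ^ k * (walkPoly (hahnRecCoeff α N) k).eval t := by
  have hN0 : (N : ℝ) ≠ 0 := by positivity
  rw [hahnQ_eq_walkPoly hα hN _ k hk, ← walkPoly_eval_neg]
  congr 1
  field_simp
  ring

/-- By the functional equation of Γ, consecutive constants have ratio a_{n+1}/(n+2). -/
theorem constD_eq_prod {α : ℝ} (hα : -(1 / 2 : ℝ) < α) {N : ℕ} (n : ℕ) : n + 1 ≤ N →
    constD α n N = (∏ j ∈ Finset.range (n + 1), hahnRecCoeff α N j) / (n + 1).factorial := by
  have hG : Real.Gamma (α + 1) ≠ 0 := (Real.Gamma_pos_of_pos (by linarith)).ne'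
  induction n with
  | zero =>
    intro h
    have hN0 : (N : ℝ) ≠ 0 := by positivity
    rw [Finset.prod_range_one, hahnRecCoeff_zero hα h, constD]
    obtain ⟨m, rfl⟩ := Nat.exists_eq_add_of_le' h
    have e1 : Real.Gamma (α + 2) = (α + 1) * Real.Gamma (α + 1) := by
      rw [← Real.Gamma_add_one (by linarith)]; congr 1; ring
    have e2 : Real.Gamma (2 * α + 3) = 2 * (α + 1) * Real.Gamma (2 * α + 2) := by
      rw [show 2 * (α + 1) = 2 * α + 2 by ring, ← Real.Gamma_add_one (by linarith)]; congr 1; ring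
    have hG2 : Real.Gamma (2 * α + 2) ≠ 0 := (Real.Gamma_pos_of_pos (by linarith)).ne'
    have h2 : α + 1 ≠ 0 := by linarith
    have h3 : (m.factorial : ℝ) ≠ 0 := by positivity
    have h4 : m + 1 - 0 - 1 = m := by omega
    simp only [Nat.cast_zero, zero_add, mul_zero, h4, e1, e2, Nat.factorial_succ,
      Nat.factorial_zero, pow_one]
    push_cast at *
    generalize Real.Gamma (2 * α + 2) = G at hG2 ⊢
    field_simp
  | succ n ih =>
    intro h
    have hih := ih (by omega)
    obtain ⟨m, rfl⟩ := Nat.exists_eq_add_of_le h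
    have hn : (0 : ℝ) ≤ n := n.cast_nonneg
    rw [Finset.prod_range_succ, Nat.factorial_succ (n + 1), Nat.cast_mul, mul_comm (((n + 1 + 1 : ℕ)) : ℝ),
      mul_div_mul_comm, ← hih, constD, constD, hahnRecCoeff]
    have e1 : Real.Gamma (((n + 1 : ℕ) : ℝ) + 2 * α + 2) =
        (n + 2 * α + 2) * Real.Gamma (n + 2 * α + 2) := by
      rw [← Real.Gamma_add_one (by linarith)]; congr 1; push_cast; ring
    have e2 : Real.Gamma (((n + 1 : ℕ) : ℝ) + α + 2) = (n + α + 2) * Real.Gamma (n + α + 2) := by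
      rw [← Real.Gamma_add_one (by linarith)]; congr 1; push_cast; ring
    have e3 : Real.Gamma (2 * ((n + 1 : ℕ) : ℝ) + 2 * α + 3) =
        (2 * n + 2 * α + 4) * ((2 * n + 2 * α + 3) * Real.Gamma (2 * n + 2 * α + 3)) := by
      rw [← Real.Gamma_add_one (by linarith : 2 * (n : ℝ) + 2 * α + 3 ≠ 0),
        show 2 * (n : ℝ) + 2 * α + 4 = 2 * n + 2 * α + 3 + 1 by ring,
        ← Real.Gamma_add_one (by linarith)]
      congr 1; push_cast; ring
    have g1 : Real.Gamma (2 * n + 2 * α + 3) ≠ 0 := (Real.Gamma_pos_of_pos (by linarith)).ne'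
    have h2 : 2 * (n : ℝ) + 2 * α + 3 ≠ 0 := by linarith
    have h5 : (n : ℝ) + α + 2 ≠ 0 := by linarith
    have h3 : (m.factorial : ℝ) ≠ 0 := by positivity
    have f1 : n + 1 + 1 + m - (n + 1) - 1 = m := by omega
    have f2 : n + 1 + 1 + m - n - 1 = m + 1 := by omega
    rw [e1, e2, e3, f1, f2, Nat.factorial_succ m, Nat.factorial_succ (n + 1)]
    have h6 : 2 * ((n + 1 : ℕ) : ℝ) + 2 * α + 1 = 2 * n + 2 * α + 3 := by push_cast; ring
    have h7 : 2 * (n : ℝ) + 2 * α + 4 = 2 * (n + α + 2) := by ring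
    have h8 : ((n + 1 + 1 + m : ℕ) : ℝ) - ((n + 1 : ℕ) : ℝ) = m + 1 := by push_cast; ring
    have h9 : ((n + 1 : ℕ) : ℝ) + 2 * α + 1 = n + 2 * α + 2 := by push_cast; ring
    have h10 : ((n + 1 + 1 + m : ℕ) : ℝ) ≠ 0 := by positivity
    rw [h6, h7, h8, h9]
    set F := ((n + 1 + 1 + m).factorial : ℝ)
    set R := ((n + 1 + 1 + m : ℕ) : ℝ)
    push_cast
    field_simp
    ring

end

/-! ### The degree condition -/

theorem mul_le_of_le_degreeBound {α : ℝ} (hα : -(1 / 2 : ℝ) < α) {N n : ℕ}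
    (hn : (n : ℝ) + 1 ≤ degreeBound α N) :
    2 * (n : ℝ) * (n + 2 * α + 1) ≤ N * (2 * α + 1) := by
  have hn0 : (0 : ℝ) ≤ n := n.cast_nonneg
  have h1 : 2 * (n : ℝ) + 2 * α + 1 ≤
      Real.sqrt ((2 * α + 1) * (2 * α + 2 * (N : ℝ) + 1)) := by
    rw [degreeBound] at hn
    linarith
  have h2 := Real.sqrt_nonneg ((2 * α + 1) * (2 * α + 2 * (N : ℝ) + 1))
  have h3 := (Real.le_sqrt' (by linarith)).mp h1
  linarith [h3]

theorem succ_le_of_mul_le {α : ℝ} (hα : -(1 / 2 : ℝ) < α) {N n : ℕ} (hN : 1 ≤ N)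
    (h : 2 * (n : ℝ) * (n + 2 * α + 1) ≤ N * (2 * α + 1)) : n + 1 ≤ N := by
  by_contra hlt
  have h1 : (N : ℝ) ≤ n := by exact_mod_cast (by omega : N ≤ n)
  have h2 : (1 : ℝ) ≤ N := by exact_mod_cast hN
  have h3 : (N : ℝ) * (2 * α + 1) ≤ n * (2 * α + 1) :=
    mul_le_mul_of_nonneg_right h1 (by linarith)
  have h4 : 0 < (n : ℝ) * (2 * n + 2 * α + 1) := mul_pos (by linarith) (by linarith)
  linarith

/-- Clearing denominators, a_j ≥ 1/2 reads 2j(j+2α+1) ≤ N(2α+1), and the left side increases with j.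
-/
theorem half_le_hahnRecCoeff {α : ℝ} (hα : -(1 / 2 : ℝ) < α) {N n j : ℕ} (hN : 1 ≤ N)
    (h : 2 * (n : ℝ) * (n + 2 * α + 1) ≤ N * (2 * α + 1)) (hj : j ≤ n) :
    1 / 2 ≤ hahnRecCoeff α N j := by
  have hj0 : (0 : ℝ) ≤ j := j.cast_nonneg
  have hjn : (j : ℝ) ≤ n := by exact_mod_cast hj
  have hN0 : (0 : ℝ) < N := by positivity
  have h1 : (j : ℝ) * (j + 2 * α + 1) ≤ n * (n + 2 * α + 1) :=
    mul_le_mul hjn (by linarith) (by linarith) (by linarith)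
  rw [hahnRecCoeff, div_le_div_iff₀ two_pos (mul_pos hN0 (by linarith))]
  linarith

/-! ### Least squares on the equidistant grid -/

section Grid

theorem grid_mem_Icc {N i : ℕ} (hN : 1 ≤ N) (hi : i ≤ N) :
    2 / (N : ℝ) * i - 1 ∈ Icc (-1 : ℝ) 1 := by
  have hN0 : (0 : ℝ) < N := by positivity
  have h1 : (i : ℝ) / N ≤ 1 := (div_le_one hN0).mpr (by exact_mod_cast hi)
  have h2 : (0 : ℝ) ≤ (i : ℝ) / N := by positivity
  rw [div_mul_eq_mul_div, mul_div_assoc]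
  constructor <;> linarith

theorem grid_injective {N : ℕ} (hN : 1 ≤ N) :
    Function.Injective fun i : ℕ => 2 / (N : ℝ) * i - 1 := by
  intro i j h
  have hN0 : (2 : ℝ) / N ≠ 0 := by positivity
  exact_mod_cast mul_left_cancel₀ hN0 (sub_left_injective h)

theorem hahnQ_natCast {α : ℝ} (hα : -(1 / 2 : ℝ) < α) {N k : ℕ} (hN : 1 ≤ N) (hk : k ≤ N) (i : ℕ) :
    hahnQ α α N k i = (-1) ^ k * (walkPoly (hahnRecCoeff α N) k).eval (2 / (N : ℝ) * i - 1) := by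
  rw [← hahnQ_grid_eq_walkPoly hα hN _ hk]
  congr 1
  have hN0 : (N : ℝ) ≠ 0 := by positivity
  field_simp
  ring

theorem sum_walkPoly_mul_walkPoly_eq_zero {α : ℝ} (hα : -(1 / 2 : ℝ) < α) {N j k : ℕ}
    (hN : 1 ≤ N) (hjk : j < k) (hk : k ≤ N) :
    ∑ i ∈ Finset.range (N + 1), hahnWeight α α N i *
      (walkPoly (hahnRecCoeff α N) j).eval (2 / (N : ℝ) * i - 1) *
      (walkPoly (hahnRecCoeff α N) k).eval (2 / (N : ℝ) * i - 1) = 0 := by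
  have h := hahnInner_hahnQ_eq_zero hα hjk hk
  simp only [hahnInner, hahnQ_natCast hα hN hk, hahnQ_natCast hα hN (hjk.le.trans hk)] at h
  have hs : ((-1 : ℝ) ^ j * (-1) ^ k) ≠ 0 :=
    mul_ne_zero (pow_ne_zero _ (by norm_num)) (pow_ne_zero _ (by norm_num))
  refine (mul_eq_zero.mp ?_).resolve_left hs
  rw [← h, Finset.mul_sum]
  exact Finset.sum_congr rfl fun i _ => by ring

theorem walkNorm_grid_pos {α : ℝ} (hα : -(1 / 2 : ℝ) < α) {N k : ℕ} (hN : 1 ≤ N) (hk : k ≤ N) :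
    0 < walkNorm (hahnRecCoeff α N) (Finset.range (N + 1)) (fun i : ℕ => 2 / (N : ℝ) * i - 1)
      (hahnWeight α α N) k := by
  refine Finset.sum_pos' (fun i hi => mul_nonneg
    (hahnWeight_pos hα (by have := Finset.mem_range.mp hi; omega)).le (sq_nonneg _))
    ⟨N, by simp, ?_⟩
  have h1 : 2 / (N : ℝ) * N - 1 = 1 := by
    have hN0 : (N : ℝ) ≠ 0 := by positivity
    rw [div_mul_cancel₀ _ hN0]; norm_num
  beta_reduce
  rw [h1, walkPoly_eval_one k fun j _ hj => (hahnRecCoeff_pos hα (by omega)).ne', one_pow, mul_one]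
  exact hahnWeight_pos hα le_rfl

theorem leastSquares_eq_sum_walkPoly {α : ℝ} (hα : -(1 / 2 : ℝ) < α) {N n : ℕ} (hN : 1 ≤ N)
    (hn : n ≤ N) (f : ℝ → ℝ) (x : ℝ) :
    leastSquares α N n f x = ∑ k ∈ Finset.range (n + 1),
      (∑ i ∈ Finset.range (N + 1), hahnWeight α α N i * f (2 / (N : ℝ) * i - 1) *
        (walkPoly (hahnRecCoeff α N) k).eval (2 / (N : ℝ) * i - 1)) /
        walkNorm (hahnRecCoeff α N) (Finset.range (N + 1)) (fun i : ℕ => 2 / (N : ℝ) * i - 1)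
          (hahnWeight α α N) k * (walkPoly (hahnRecCoeff α N) k).eval x := by
  refine Finset.sum_congr rfl fun k hk => ?_
  have hkN : k ≤ N := by have := Finset.mem_range.mp hk; omega
  have hs : ((-1 : ℝ) ^ k) * (-1) ^ k = 1 := by rw [← mul_pow]; norm_num
  simp only [hahnInner, hahnQ_natCast hα hN hkN, hahnQ_grid_eq_walkPoly hα hN _ hkN, walkNorm]
  have h1 : ∀ i : ℕ, f (2 / (N : ℝ) * i - 1) *
      ((-1) ^ k * (walkPoly (hahnRecCoeff α N) k).eval (2 / (N : ℝ) * i - 1)) *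
        hahnWeight α α N i = (-1) ^ k * (hahnWeight α α N i * f (2 / (N : ℝ) * i - 1) *
        (walkPoly (hahnRecCoeff α N) k).eval (2 / (N : ℝ) * i - 1)) := fun i => by ring
  have h2 : ∀ i : ℕ, (-1) ^ k * (walkPoly (hahnRecCoeff α N) k).eval (2 / (N : ℝ) * i - 1) *
      ((-1) ^ k * (walkPoly (hahnRecCoeff α N) k).eval (2 / (N : ℝ) * i - 1)) *
        hahnWeight α α N i = hahnWeight α α N i *
        (walkPoly (hahnRecCoeff α N) k).eval (2 / (N : ℝ) * i - 1) ^ 2 := fun i => by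
    linear_combination (hahnWeight α α N i *
        (walkPoly (hahnRecCoeff α N) k).eval (2 / (N : ℝ) * i - 1) ^ 2) * hs
  simp only [h1, h2, ← Finset.mul_sum]
  rw [mul_div_assoc, mul_mul_mul_comm, hs, one_mul]

theorem lt_card_image_grid {N : ℕ} (hN : 1 ≤ N) {p : ℕ → Prop} [DecidablePred p] {g : ℕ → ℕ}
    (hg : Function.Injective g) (hp : ∀ i < N, g i ≤ N ∧ p (g i)) :
    N ≤ (((Finset.range (N + 1)).filter p).image fun i : ℕ => 2 / (N : ℝ) * i - 1).card := by
  rw [Finset.card_image_of_injective _ (grid_injective hN)]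
  calc N = ((Finset.range N).image g).card := by
        rw [Finset.card_image_of_injective _ hg, Finset.card_range]
    _ ≤ _ := Finset.card_le_card fun i hi => by
        obtain ⟨j, hj, rfl⟩ := Finset.mem_image.mp hi
        obtain ⟨h1, h2⟩ := hp j (Finset.mem_range.mp hj)
        exact Finset.mem_filter.mpr ⟨Finset.mem_range.mpr (by omega), h2⟩

theorem abs_sub_leastSquares_le {α : ℝ} (hα : -(1 / 2 : ℝ) < α) {N n : ℕ} (hN : 1 ≤ N)
    (h : 2 * (n : ℝ) * (n + 2 * α + 1) ≤ N * (2 * α + 1)) {f : ℝ → ℝ} {M : ℝ}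
    (hf : ContDiffOn ℝ ((n + 1 : ℕ) : WithTop ℕ∞) f (Icc (-1) 1))
    (hM : ∀ ξ ∈ Icc (-1 : ℝ) 1, |iteratedDerivWithin (n + 1) f (Icc (-1) 1) ξ| ≤ M)
    {x : ℝ} (hx : x ∈ Icc (-1 : ℝ) 1) : |f x - leastSquares α N n f x| ≤ constD α n N * M := by
  have hnN := succ_le_of_mul_le hα hN h
  have hN0 : (0 : ℝ) < N := by positivity
  rw [leastSquares_eq_sum_walkPoly hα hN (by omega), constD_eq_prod hα n hnN]
  have hmem : ∀ i ∈ Finset.range (N + 1), i ≤ N := fun i hi => by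
    have := Finset.mem_range.mp hi; omega
  refine abs_sub_sum_walkPoly_le (t := fun i : ℕ => 2 / (N : ℝ) * i - 1)
    (hahnRecCoeff_zero hα hN) (fun j _ hj => half_le_hahnRecCoeff hα hN h hj)
    (fun i hi => grid_mem_Icc hN (hmem i hi)) (fun i hi => (hahnWeight_pos hα (hmem i hi)).le)
    (fun j k hjk hk => sum_walkPoly_mul_walkPoly_eq_zero hα hN hjk (by omega))
    (fun k hk => walkNorm_grid_pos hα hN (by omega)) ?_ ?_ hf hM hx
  -- The factor 1 - t kills only the node 1, and below 1 + t kills only the node -1; in each case N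
  -- > n nodes keep positive weight.
  · refine lt_of_lt_of_le hnN (lt_card_image_grid hN (g := id) Function.injective_id
      fun i hi => ⟨hi.le, mul_pos (hahnWeight_pos hα hi.le) ?_⟩)
    have : (i : ℝ) / N < 1 := (div_lt_one hN0).mpr (by exact_mod_cast hi)
    rw [id, div_mul_eq_mul_div, mul_div_assoc]
    linarith
  · refine lt_of_lt_of_le hnN (lt_card_image_grid hN (g := fun i => i + 1) (add_left_injective 1)
      fun i hi => ⟨hi, mul_pos (hahnWeight_pos hα hi) ?_⟩)
    rw [add_sub_cancel]
    positivity

theorem leastSquares_walkPoly_eq_zero {α : ℝ} (hα : -(1 / 2 : ℝ) < α) {N n : ℕ} (hN : 1 ≤ N)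
    (hn : n + 1 ≤ N) (x : ℝ) :
    leastSquares α N n (fun t => (walkPoly (hahnRecCoeff α N) (n + 1)).eval t) x = 0 := by
  rw [leastSquares_eq_sum_walkPoly hα hN (by omega)]
  refine Finset.sum_eq_zero fun k hk => ?_
  rw [← zero_mul ((walkPoly (hahnRecCoeff α N) k).eval x), ← zero_div (walkNorm _ _ _ _ _),
    ← sum_walkPoly_mul_walkPoly_eq_zero hα hN (Finset.mem_range.mp hk) hn]
  congr 2
  exact Finset.sum_congr rfl fun i _ => by ring

end Grid

/-! ### Supremum norm and the main theorem -/

section SupNorm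

theorem supNorm_le {g : ℝ → ℝ} {B : ℝ} (h : ∀ x ∈ Icc (-1 : ℝ) 1, |g x| ≤ B) : supNorm g ≤ B :=
  csSup_le ((nonempty_Icc.mpr (by norm_num)).image _) (by rintro _ ⟨x, hx, rfl⟩; exact h x hx)

theorem abs_le_supNorm {g : ℝ → ℝ} (hg : ContinuousOn g (Icc (-1) 1)) {x : ℝ}
    (hx : x ∈ Icc (-1 : ℝ) 1) : |g x| ≤ supNorm g :=
  le_csSup (isCompact_Icc.bddAbove_image hg.abs) (mem_image_of_mem _ hx)

end SupNorm

theorem mainTheorem1 (α : ℝ) (hα : -(1 / 2 : ℝ) < α) (N : ℕ) (hN : 1 ≤ N) (n : ℕ)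
    (hn : (n : ℝ) + 1 ≤ degreeBound α N) :
    (∀ f : ℝ → ℝ, ContDiffOn ℝ ((n + 1 : ℕ) : WithTop ℕ∞) f (Set.Icc (-1) 1) →
      supNorm (fun x => f x - leastSquares α N n f x) ≤
        constD α n N * supNorm (iteratedDerivWithin (n + 1) f (Set.Icc (-1) 1))) ∧
    (∀ C : ℝ,
      (∀ f : ℝ → ℝ, ContDiffOn ℝ ((n + 1 : ℕ) : WithTop ℕ∞) f (Set.Icc (-1) 1) →
        supNorm (fun x => f x - leastSquares α N n f x) ≤
          C * supNorm (iteratedDerivWithin (n + 1) f (Set.Icc (-1) 1))) →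
      constD α n N ≤ C) := by
  have h := mul_le_of_le_degreeBound hα hn
  have hnN := succ_le_of_mul_le hα hN h
  refine ⟨fun f hf => supNorm_le fun x hx => abs_sub_leastSquares_le hα hN h hf
    (fun ξ hξ => abs_le_supNorm (hf.continuousOn_iteratedDerivWithin le_rfl
      (uniqueDiffOn_Icc (by norm_num))) hξ) hx, fun C hC => ?_⟩
  -- The extremal function: it is orthogonal to all lower degrees, so its error is q itself, at
  -- least 1 in norm.
  set q := walkPoly (hahnRecCoeff α N) (n + 1) with hq
  have hpos : 0 < ∏ j ∈ Finset.range (n + 1), hahnRecCoeff α N j := Finset.prod_pos fun j hj =>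
    hahnRecCoeff_pos hα (by have := Finset.mem_range.mp hj; omega)
  have hC0 := hC (fun t => q.eval t) (polynomial_contDiff q).contDiffOn
  have hone : 1 ≤ supNorm fun x => q.eval x - leastSquares α N n (fun t => q.eval t) x := by
    simp only [hq, leastSquares_walkPoly_eq_zero hα hN hnN, sub_zero]
    refine le_trans ?_ (abs_le_supNorm q.continuousOn (right_mem_Icc.mpr (by norm_num)))
    rw [hq, walkPoly_eval_one (n + 1) fun j _ hj => (hahnRecCoeff_pos hα (by omega)).ne', abs_one]
  have hder : supNorm (iteratedDerivWithin (n + 1) (fun t => q.eval t) (Icc (-1) 1)) =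
      (n + 1).factorial / ∏ j ∈ Finset.range (n + 1), hahnRecCoeff α N j := by
    have hval : ∀ x ∈ Icc (-1 : ℝ) 1,
        |iteratedDerivWithin (n + 1) (fun t => q.eval t) (Icc (-1) 1) x| =
          (n + 1).factorial / ∏ j ∈ Finset.range (n + 1), hahnRecCoeff α N j := fun x hx => by
      rw [iteratedDerivWithin_polynomial_eval q (walkPoly_natDegree_le _) hx,
        walkPoly_coeff (hahnRecCoeff_zero hα hN), Finset.prod_inv_distrib, ← div_eq_mul_inv,
        abs_of_pos (by positivity)]
    exact le_antisymm (supNorm_le fun x hx => (hval x hx).le) ((hval 1 (by simp)).symm.le.trans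
      (abs_le_supNorm ((polynomial_contDiff q).contDiffOn.continuousOn_iteratedDerivWithin le_rfl
        (uniqueDiffOn_Icc (by norm_num))) (by simp)))
  rw [hder] at hC0
  rw [constD_eq_prod hα n hnN, div_le_iff₀ (by positivity)]
  have := hone.trans hC0
  rwa [mul_div_assoc', le_div_iff₀ hpos, one_mul] at this
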